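/- Let $k$ be a field. A \emph{tensor category over $k$} is a monoidal category $\mathcal C$ in which every object has a left dual and a right dual, endowed with a structure of $k$-linear abelian category such that the monoidal product is $k$-bilinear on morphisms and $\operatorname{End}(\mathbf 1)=k$. It is \emph{finite} if it is $k$-linearly equivalent to the category of finite-dimensional left modules over some finite-dimensional $k$-algebra. For a $k$-algebra $R$ put $R^e=R\otimes_k R^{\mathrm{op}}$ and identify left $R^e$-modules with $R$-bimodules (on which $k$ acts the same way on both sides); they form a monoidal category with product $\otimes_R$ and unit $R$. A \emph{left bialgebroid with base $R$} is a $k$-algebra $A$ with $k$-algebra morphisms $s\colon R\to A$ and $t\colon R^{\mathrm{op}}\to A$ whose images commute, giving $e\colon R^e\to A$, $e(r\otimes r')=s(r)t(r')$, together with a coalgebra structure $(\Delta,\varepsilon)$ on ${}_eA$ in the monoidal category of $R$-bimodules such that: $\Delta$ takes its values in $$A\times_R A=\Bigl\{\textstyle\sum a_i\otimes b_i\in {}_eA\otimes_R {}_eA \;\Bigm|\; \sum a_it(r)\otimes b_i=\sum a_i\otimes b_is(r)\ \text{for all } r\in R\Bigr\}$$ and is an algebra morphism for the product $(a\otimes b)(a'\otimes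 b')=aa'\otimes bb'$ of $A\times_RA$; $\varepsilon(1)=1$; and $\varepsilon(a\,s(\varepsilon(a')))=\varepsilon(aa')=\varepsilon(a\,t(\varepsilon(a')))$ for all $a,a'\in A$. Write $\Delta(a)=a_{(1)}\otimes a_{(2)}$. Such an $A$ defines a bimonad $T_A(M)=A\otimes_{R^e}M$ on the category of $R$-bimodules, and $A$ is a \emph{left Hopf algebroid} if $T_A$ is a left Hopf monad, i.e. if for all $R$-bimodules $M,N$ the left fusion operator $$A\otimes_{R^e}\bigl(M\otimes_R(A\otimes_{R^e}N)\bigr)\to (A\otimes_{R^e}M)\otimes_R(A\otimes_{R^e}N),\qquad a\otimes m\otimes b\otimes n\mapsto (a_{(1)}\otimes m)\otimes (a_{(2)}b\otimes n)$$ is bijective. If $R$ is finite-dimensional, the finite-dimensional left $A$-modules form a $k$-linear monoidal category $A\text{-}\mathrm{mod}$ with product $M\otimes_RN$ (via ${}_eM$, ${}_eN$), action $a(m\otimes n)=a_{(1)}m\otimes a_{(2)}n$, and unit $R$ with action $a\cdot r=\varepsilon(a\,s(r))$. \textbf{Theorem.} Let $\mathcal C$ be a finite tensor category over a field $k$. Then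 there exist a finite-dimensional $k$-algebra $R$ and a finite-dimensional left Hopf algebroid $A$ over $k$ with base $R$ such that $\mathcal C$ is equivalent, as a tensor category, to the category of finite-dimensional left $A$-modules; that is, there is a $k$-linear strong monoidal equivalence of categories $\mathcal C\simeq A\text{-}\mathrm{mod}$. -/

import Mathlib

open CategoryTheory MonoidalCategory TensorProduct MulOpposite

universe u v w

noncomputable section

section BalancedTensor

variable {ι M N P : Type*} [AddCommGroup M] [AddCommGroup N] [AddCommGroup P]

/-- The tensor product of abelian groups `M ⊗_ℤ N` modulo the relations
`p i m ⊗ n = m ⊗ q i n`. If `p` is a right action of a ring `S` on `M` and `q` is a left action of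
`S` on `N`, this is the tensor product `M ⊗_S N` over the (noncommutative) ring `S`. -/
def BalancedTensor (p : ι → M →+ M) (q : ι → N →+ N) : Type _ :=
  (M ⊗[ℤ] N) ⧸ AddSubgroup.closure
    {z : M ⊗[ℤ] N | ∃ (i : ι) (m : M) (n : N), z = p i m ⊗ₜ[ℤ] n - m ⊗ₜ[ℤ] q i n}

namespace BalancedTensor

variable (p : ι → M →+ M) (q : ι → N →+ N)

instance : AddCommGroup (BalancedTensor p q) :=
  inferInstanceAs (AddCommGroup ((M ⊗[ℤ] N) ⧸ AddSubgroup.closure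
    {z : M ⊗[ℤ] N | ∃ (i : ι) (m : M) (n : N), z = p i m ⊗ₜ[ℤ] n - m ⊗ₜ[ℤ] q i n}))

/-- The projection from the tensor product over `ℤ`. -/
def proj : M ⊗[ℤ] N →+ BalancedTensor p q := QuotientAddGroup.mk' _

lemma proj_surjective : Function.Surjective (proj p q) := QuotientAddGroup.mk'_surjective _

/-- The class `m ⊗ n`. -/
def tmul (m : M) (n : N) : BalancedTensor p q := proj p q (m ⊗ₜ[ℤ] n)

variable {p q}

lemma tmul_add (m : M) (n n' : N) : tmul p q m (n + n') = tmul p q m n + tmul p q m n' := by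
  simp [tmul, TensorProduct.tmul_add]

lemma add_tmul (m m' : M) (n : N) : tmul p q (m + m') n = tmul p q m n + tmul p q m' n := by
  simp [tmul, TensorProduct.add_tmul]

lemma tmul_balanced (i : ι) (m : M) (n : N) : tmul p q (p i m) n = tmul p q m (q i n) := by
  rw [← sub_eq_zero]
  unfold tmul
  rw [← map_sub]
  exact (QuotientAddGroup.eq_zero_iff _).2 (AddSubgroup.subset_closure ⟨i, m, n, rfl⟩)

/-- The universal property: additive maps out of the balanced tensor product. -/
def lift (f : M → N → P) (h₁ : ∀ m m' n, f (m + m') n = f m n + f m' n)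
    (h₂ : ∀ m n n', f m (n + n') = f m n + f m n') (h : ∀ i m n, f (p i m) n = f m (q i n)) :
    BalancedTensor p q →+ P :=
  let F : M ⊗[ℤ] N →+ P := TensorProduct.liftAddHom
    (AddMonoidHom.mk' (fun m => AddMonoidHom.mk' (f m) (h₂ m))
      (fun m m' => AddMonoidHom.ext fun n => h₁ m m' n))
    (fun z m n => by
      have e₁ := (AddMonoidHom.mk' (fun m => f m n) fun m m' => h₁ m m' n).map_zsmul z m
      have e₂ := (AddMonoidHom.mk' (f m) (h₂ m)).map_zsmul z n
      exact e₁.trans e₂.symm)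
  QuotientAddGroup.lift _ F <| by
    rw [AddSubgroup.closure_le]
    rintro _ ⟨i, m, n, rfl⟩
    have e : F (p i m ⊗ₜ[ℤ] n) = F (m ⊗ₜ[ℤ] q i n) := h i m n
    simp [AddMonoidHom.mem_ker, e]

@[simp] lemma lift_tmul (f : M → N → P) (h₁ h₂ h) (m : M) (n : N) :
    lift (p := p) (q := q) f h₁ h₂ h (tmul p q m n) = f m n := rfl

@[elab_as_elim]
lemma induction_on {C : BalancedTensor p q → Prop} (z : BalancedTensor p q)
    (tmul : ∀ m n, C (tmul p q m n)) (add : ∀ x y, C x → C y → C (x + y)) : C z := by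
  obtain ⟨z, rfl⟩ := proj_surjective p q z
  induction z using TensorProduct.induction_on with
  | zero =>
    have := tmul 0 0
    rwa [BalancedTensor.tmul, TensorProduct.zero_tmul] at this
  | tmul m n => exact tmul m n
  | add x y hx hy => rw [map_add]; exact add _ _ hx hy

lemma hom_ext {f g : BalancedTensor p q →+ P} (h : ∀ m n, f (tmul p q m n) = g (tmul p q m n)) :
    f = g := by
  ext z
  induction z using induction_on with
  | tmul m n => exact h m n
  | add x y hx hy => rw [map_add, map_add, hx, hy]

end BalancedTensor

end BalancedTensor

section Bimodules

variable (k : Type w) [CommRing k] (R : Type w) [Ring R] [Algebra k R]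

/-- The enveloping algebra `Rᵉ = R ⊗ Rᵒᵖ`. -/
abbrev Envelope : Type w := R ⊗[k] Rᵐᵒᵖ

variable {R}
/-- The element `r ⊗ 1` of the enveloping algebra. -/
abbrev Envelope.left (r : R) : Envelope k R := r ⊗ₜ[k] (1 : Rᵐᵒᵖ)

/-- The element `1 ⊗ r` of the enveloping algebra. -/
abbrev Envelope.right (r : R) : Envelope k R := (1 : R) ⊗ₜ[k] (op r)


lemma Envelope.right_mul_left (r s : R) :
    Envelope.left k r * Envelope.right k s = Envelope.right k s * Envelope.left k r := by
  simp

lemma Envelope.tmul_eq (r : R) (r' : Rᵐᵒᵖ) :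
    (r ⊗ₜ[k] r' : Envelope k R) = Envelope.left k r * Envelope.right k (unop r') := by
  simp

variable (R)

variable (M N P : Type w) [AddCommGroup M] [AddCommGroup N] [AddCommGroup P]
  [Module (Envelope k R) M] [Module (Envelope k R) N] [Module (Envelope k R) P]

variable {k R M N} in
/-- An additive map between `Rᵉ`-modules that commutes with the action of pure tensors. -/
def Envelope.linearMap (f : M →+ N)
    (h : ∀ (r : R) (r' : Rᵐᵒᵖ) (m : M), f ((r ⊗ₜ[k] r' : Envelope k R) • m) =
      (r ⊗ₜ[k] r' : Envelope k R) • f m) : M →ₗ[Envelope k R] N where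
  toFun := f
  map_add' := map_add f
  map_smul' x m := by
    induction x using TensorProduct.induction_on with
    | zero => 
      have h₁ : (0 : Envelope k R) • m = 0 := zero_smul (Envelope k R) m
      have h₂ : (0 : Envelope k R) • f m = 0 := zero_smul (Envelope k R) (f m)
      exact (congrArg f h₁).trans ((map_zero f).trans h₂.symm)
    | tmul r r' => exact h r r' m
    | add x y hx hy =>
      rw [add_smul, map_add, hx, hy]
      simp only [RingHom.id_apply, add_smul]

/-- The tensor product `M ⊗_R N` of two `R`-bimodules -/
def BimodTensor : Type w :=
  BalancedTensor (fun r : R => DistribSMul.toAddMonoidHom M (Envelope.right k r))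
    (fun r : R => DistribSMul.toAddMonoidHom N (Envelope.left k r))

namespace BimodTensor

instance : AddCommGroup (BimodTensor k R M N) := by
  unfold BimodTensor; infer_instance

variable {M N P}

/-- The class `m ⊗ n`. -/
def tmul (m : M) (n : N) : BimodTensor k R M N := BalancedTensor.tmul _ _ m n

variable {k R}

lemma tmul_add (m : M) (n n' : N) : tmul k R m (n + n') = tmul k R m n + tmul k R m n' :=
  BalancedTensor.tmul_add ..

lemma add_tmul (m m' : M) (n : N) : tmul k R (m + m') n = tmul k R m n + tmul k R m' n :=
  BalancedTensor.add_tmul ..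

lemma smul_tmul (r : R) (m : M) (n : N) :
    tmul k R (Envelope.right k r • m) n = tmul k R m (Envelope.left k r • n) :=
  BalancedTensor.tmul_balanced r m n

def lift {Q : Type*} [AddCommGroup Q] (f : M → N → Q)
    (h₁ : ∀ m m' n, f (m + m') n = f m n + f m' n)
    (h₂ : ∀ m n n', f m (n + n') = f m n + f m n')
    (h : ∀ (r : R) m n, f (Envelope.right k r • m) n = f m (Envelope.left k r • n)) :
    BimodTensor k R M N →+ Q :=
  BalancedTensor.lift f h₁ h₂ h

@[simp] lemma lift_tmul {Q : Type*} [AddCommGroup Q] (f : M → N → Q) (h₁ h₂ h) (m : M) (n : N) :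
    lift (k := k) (R := R) f h₁ h₂ h (tmul k R m n) = f m n := rfl

@[elab_as_elim]
lemma induction_on {C : BimodTensor k R M N → Prop} (z : BimodTensor k R M N)
    (tmul : ∀ m n, C (tmul k R m n)) (add : ∀ x y, C x → C y → C (x + y)) : C z :=
  BalancedTensor.induction_on z tmul add

lemma hom_ext {Q : Type*} [AddCommGroup Q] {f g : BimodTensor k R M N →+ Q}
    (h : ∀ m n, f (tmul k R m n) = g (tmul k R m n)) : f = g :=
  BalancedTensor.hom_ext h

/-- The endomorphism `m ⊗ n ↦ r m ⊗ n r'`. -/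
def actAux (r : R) (r' : Rᵐᵒᵖ) : BimodTensor k R M N →+ BimodTensor k R M N :=
  lift (fun m n => tmul k R (Envelope.left k r • m) (Envelope.right k (unop r') • n))
    (fun m m' n => by rw [smul_add, add_tmul]) (fun m n n' => by rw [smul_add, tmul_add])
    (fun s m n => by
      rw [smul_smul, Envelope.right_mul_left, ← smul_smul, smul_tmul, smul_smul, smul_smul,
        Envelope.right_mul_left])

/-- The action of the enveloping algebra on `M ⊗_R N`. -/
def act : Envelope k R →+ (BimodTensor k R M N →+ BimodTensor k R M N) :=
  TensorProduct.liftAddHom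
    (AddMonoidHom.mk' (fun r => AddMonoidHom.mk' (fun r' => actAux (M := M) (N := N) r r')
        (fun a b => hom_ext fun m n => by
          change tmul k R (Envelope.left k r • m) ((1 ⊗ₜ[k] (a + b) : Envelope k R) • n) =
            tmul k R (Envelope.left k r • m) ((1 ⊗ₜ[k] a : Envelope k R) • n) +
              tmul k R (Envelope.left k r • m) ((1 ⊗ₜ[k] b : Envelope k R) • n)
          rw [TensorProduct.tmul_add, add_smul, tmul_add]))
      (fun a b => AddMonoidHom.ext fun r' => hom_ext fun m n => by
          change tmul k R (((a + b) ⊗ₜ[k] 1 : Envelope k R) • m) (Envelope.right k (unop r') • n) =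
            tmul k R ((a ⊗ₜ[k] 1 : Envelope k R) • m) (Envelope.right k (unop r') • n) +
              tmul k R ((b ⊗ₜ[k] 1 : Envelope k R) • m) (Envelope.right k (unop r') • n)
          rw [TensorProduct.add_tmul, add_smul, add_tmul]))
    (fun c r r' => hom_ext fun m n => by
      have h₁ : Envelope.left k (c • r) = Envelope.right k (c • (1 : R)) * Envelope.left k r := by
        simp [TensorProduct.smul_tmul]
      have h₂ : Envelope.right k (unop (c • r')) =
          Envelope.left k (c • (1 : R)) * Envelope.right k (unop r') := by
        rw [Algebra.TensorProduct.tmul_mul_tmul, mul_one, one_mul]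
        exact (TensorProduct.smul_tmul c 1 r').symm
      change tmul k R (Envelope.left k (c • r) • m) (Envelope.right k (unop r') • n) =
        tmul k R (Envelope.left k r • m) (Envelope.right k (unop (c • r')) • n)
      rw [h₁, h₂, ← smul_smul, ← smul_smul, smul_tmul])

lemma act_tmul (r : R) (r' : Rᵐᵒᵖ) (m : M) (n : N) :
    act (r ⊗ₜ[k] r') (tmul k R m n) =
      tmul k R (Envelope.left k r • m) (Envelope.right k (unop r') • n) := rfl

instance : Module (Envelope k R) (BimodTensor k R M N) where
  smul x z := act x z
  one_smul z := by
    change act 1 z = z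
    induction z using induction_on with
    | tmul m n =>
      rw [Algebra.TensorProduct.one_def, act_tmul]
      change tmul k R ((1 : Envelope k R) • m) ((1 : Envelope k R) • n) = _
      rw [one_smul, one_smul]
    | add x y hx hy => rw [map_add, hx, hy]
  mul_smul x y z := by
    change act (x * y) z = act x (act y z)
    induction x using TensorProduct.induction_on with
    | zero => simp
    | add a b ha hb => rw [add_mul, map_add, map_add, AddMonoidHom.add_apply, AddMonoidHom.add_apply, ha, hb]
    | tmul a a' =>
      induction y using TensorProduct.induction_on with
      | zero => simp
      | add c d hc hd =>
        rw [mul_add, map_add, map_add, AddMonoidHom.add_apply, AddMonoidHom.add_apply, map_add,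
          hc, hd]
      | tmul b b' =>
        induction z using induction_on with
        | add u v hu hv => rw [map_add, map_add, map_add, hu, hv]
        | tmul m n =>
          rw [Algebra.TensorProduct.tmul_mul_tmul, act_tmul, act_tmul, act_tmul, smul_smul,
            smul_smul]
          simp [Envelope.left, Envelope.right]
  smul_zero x := map_zero (act x)
  smul_add x := map_add (act x)
  zero_smul z := by change act 0 z = 0; simp
  add_smul x y z := by change act (x + y) z = act x z + act y z; simp

@[simp] lemma smul_tmul' (r : R) (r' : Rᵐᵒᵖ) (m : M) (n : N) :
    (r ⊗ₜ[k] r' : Envelope k R) • tmul k R m n =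
      tmul k R (Envelope.left k r • m) (Envelope.right k (unop r') • n) := rfl

variable {M' N' : Type w} [AddCommGroup M'] [AddCommGroup N']
  [Module (Envelope k R) M'] [Module (Envelope k R) N']

/-- Functoriality of the tensor product. -/
def map (f : M →ₗ[Envelope k R] M') (g : N →ₗ[Envelope k R] N') :
    BimodTensor k R M N →ₗ[Envelope k R] BimodTensor k R M' N' :=
  Envelope.linearMap
    (lift (fun m n => tmul k R (f m) (g n)) (fun m m' n => by rw [map_add, add_tmul])
      (fun m n n' => by rw [map_add, tmul_add])
      (fun r m n => by rw [map_smul, map_smul, smul_tmul]))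
    (fun r r' z => by
      induction z using induction_on with
      | tmul m n => simp
      | add x y hx hy => rw [smul_add, map_add, map_add, smul_add, hx, hy])

@[simp] lemma map_tmul (f : M →ₗ[Envelope k R] M') (g : N →ₗ[Envelope k R] N') (m : M) (n : N) :
    map f g (tmul k R m n) = tmul k R (f m) (g n) := rfl

lemma linearMap_ext {f g : BimodTensor k R M N →ₗ[Envelope k R] P}
    (h : ∀ m n, f (tmul k R m n) = g (tmul k R m n)) : f = g :=
  LinearMap.toAddMonoidHom_injective (hom_ext h)

lemma right_smul_tmul (r : R) (m : M) (n : N) :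
    Envelope.right k r • tmul k R m n = tmul k R m (Envelope.right k r • n) := by
  rw [smul_tmul']
  change tmul k R ((1 : Envelope k R) • m) _ = _
  rw [one_smul]; rfl

lemma left_smul_tmul (r : R) (m : M) (n : N) :
    Envelope.left k r • tmul k R m n = tmul k R (Envelope.left k r • m) n := by
  rw [smul_tmul']
  change tmul k R _ ((1 : Envelope k R) • n) = _
  rw [one_smul]

/-- The map `m ⊗ n ↦ m ⊗ (n ⊗ p)`. -/
def assocHomAux (p : P) : BimodTensor k R M N →+ BimodTensor k R M (BimodTensor k R N P) :=
  lift (fun m n => tmul k R m (tmul k R n p))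
    (fun m m' n => by rw [add_tmul]) (fun m n n' => by rw [add_tmul, tmul_add])
    (fun r m n => by rw [smul_tmul, left_smul_tmul])

lemma assocHomAux_tmul (m : M) (n : N) (p : P) :
    assocHomAux p (tmul k R m n) = tmul k R m (tmul k R n p) := rfl

/-- The map `(m ⊗ n) ⊗ p ↦ m ⊗ (n ⊗ p)`. -/
def assocHom : BimodTensor k R (BimodTensor k R M N) P →ₗ[Envelope k R]
    BimodTensor k R M (BimodTensor k R N P) :=
  Envelope.linearMap
    (lift (fun z p => assocHomAux p z)
      (fun z z' p => map_add _ _ _)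
      (fun z p p' => by
        induction z using induction_on with
        | tmul m n => simp only [assocHomAux_tmul, tmul_add]
        | add x y hx hy => rw [map_add, map_add, map_add, hx, hy]; abel)
      (fun r z p => by
        induction z using induction_on with
        | tmul m n => rw [right_smul_tmul, assocHomAux_tmul, assocHomAux_tmul, smul_tmul]
        | add x y hx hy => rw [smul_add, map_add, map_add, hx, hy]))
    (fun r r' z => by
      induction z using induction_on with
      | add x y hx hy => rw [smul_add, map_add, map_add, smul_add, hx, hy]
      | tmul z p =>
        induction z using induction_on with
        | add x y hx hy => rw [add_tmul, smul_add, map_add, map_add, smul_add, hx, hy]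
        | tmul m n =>
          rw [smul_tmul', left_smul_tmul, lift_tmul, lift_tmul, assocHomAux_tmul,
            assocHomAux_tmul, smul_tmul', right_smul_tmul])

/-- The map `n ⊗ p ↦ (m ⊗ n) ⊗ p`. -/
def assocInvAux (m : M) : BimodTensor k R N P →+ BimodTensor k R (BimodTensor k R M N) P :=
  lift (fun n p => tmul k R (tmul k R m n) p)
    (fun n n' p => by rw [tmul_add, add_tmul]) (fun n p p' => by rw [tmul_add])
    (fun r n p => by rw [← right_smul_tmul, smul_tmul])

lemma assocInvAux_tmul (m : M) (n : N) (p : P) :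
    assocInvAux m (tmul k R n p) = tmul k R (tmul k R m n) p := rfl

/-- The map `m ⊗ (n ⊗ p) ↦ (m ⊗ n) ⊗ p`. -/
def assocInv : BimodTensor k R M (BimodTensor k R N P) →ₗ[Envelope k R]
    BimodTensor k R (BimodTensor k R M N) P :=
  Envelope.linearMap
    (lift (fun m z => assocInvAux m z)
      (fun m m' z => by
        induction z using induction_on with
        | tmul n p => simp only [assocInvAux_tmul, add_tmul]
        | add x y hx hy => rw [map_add, map_add, map_add, hx, hy]; abel)
      (fun m z z' => map_add _ _ _)
      (fun r m z => by
        induction z using induction_on with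
        | tmul n p => rw [left_smul_tmul, assocInvAux_tmul, assocInvAux_tmul, smul_tmul]
        | add x y hx hy => rw [smul_add, map_add, map_add, hx, hy]))
    (fun r r' z => by
      induction z using induction_on with
      | add x y hx hy => rw [smul_add, map_add, map_add, smul_add, hx, hy]
      | tmul m z =>
        induction z using induction_on with
        | add x y hx hy => rw [tmul_add, smul_add, map_add, map_add, smul_add, hx, hy]
        | tmul n p =>
          rw [smul_tmul', right_smul_tmul, lift_tmul, lift_tmul, assocInvAux_tmul,
            assocInvAux_tmul, smul_tmul', left_smul_tmul])

@[simp] lemma assocHom_tmul (m : M) (n : N) (p : P) :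
    assocHom (tmul k R (tmul k R m n) p) = tmul k R m (tmul k R n p) := rfl

@[simp] lemma assocInv_tmul (m : M) (n : N) (p : P) :
    assocInv (tmul k R m (tmul k R n p)) = tmul k R (tmul k R m n) p := rfl

lemma linearMap_ext_left {Q : Type w} [AddCommGroup Q] [Module (Envelope k R) Q]
    {f g : BimodTensor k R (BimodTensor k R M N) P →ₗ[Envelope k R] Q}
    (h : ∀ m n p, f (tmul k R (tmul k R m n) p) = g (tmul k R (tmul k R m n) p)) : f = g :=
  linearMap_ext fun z p => by
    induction z using induction_on with
    | tmul m n => exact h m n p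
    | add x y hx hy => rw [add_tmul, map_add, map_add, hx, hy]

lemma linearMap_ext_right {Q : Type w} [AddCommGroup Q] [Module (Envelope k R) Q]
    {f g : BimodTensor k R M (BimodTensor k R N P) →ₗ[Envelope k R] Q}
    (h : ∀ m n p, f (tmul k R m (tmul k R n p)) = g (tmul k R m (tmul k R n p))) : f = g :=
  linearMap_ext fun m z => by
    induction z using induction_on with
    | tmul n p => exact h m n p
    | add x y hx hy => rw [tmul_add, map_add, map_add, hx, hy]

/-- The associativity isomorphism `(M ⊗_R N) ⊗_R P ≃ M ⊗_R (N ⊗_R P)`. -/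
def assoc : BimodTensor k R (BimodTensor k R M N) P ≃ₗ[Envelope k R]
    BimodTensor k R M (BimodTensor k R N P) :=
  LinearEquiv.ofLinearMap assocHom assocInv (linearMap_ext_right fun _ _ _ => rfl)
    (linearMap_ext_left fun _ _ _ => rfl)

end BimodTensor

/-- The ring `R` regarded as an `R`-bimodule, with action `(r ⊗ r') x = r x r'`. -/
def UnitBimod (k : Type w) [CommRing k] (R : Type w) [Ring R] [Algebra k R] : Type w := R

namespace UnitBimod

variable {k R}

instance : AddCommGroup (UnitBimod k R) := inferInstanceAs (AddCommGroup R)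

instance : Module (Envelope k R) (UnitBimod k R) := instModuleTensorProductMop k R

variable (k) in
/-- The element of the bimodule `R` given by `r : R`. -/
def of (r : R) : UnitBimod k R := r

/-- The element of `R` underlying an element of the bimodule `R`. -/
def val (x : UnitBimod k R) : R := x

@[simp] lemma val_of (r : R) : (of k r).val = r := rfl
@[simp] lemma of_val (x : UnitBimod k R) : of k x.val = x := rfl
@[simp] lemma val_add (x y : UnitBimod k R) : (x + y).val = x.val + y.val := rfl
@[simp] lemma of_add (x y : R) : of k (x + y) = of k x + of k y := rfl

lemma smul_eq (r : R) (r' : Rᵐᵒᵖ) (x : UnitBimod k R) :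
    (r ⊗ₜ[k] r' : Envelope k R) • x = of k (r * (x.val * unop r')) :=
  TensorProduct.Algebra.smul_def (R := k) r r' x.val

lemma left_smul_one (x : UnitBimod k R) : Envelope.left k x.val • of k (1 : R) = x := by
  rw [smul_eq]; simp

lemma right_smul_one (x : UnitBimod k R) : Envelope.right k x.val • of k (1 : R) = x := by
  rw [smul_eq]; simp

end UnitBimod

namespace BimodTensor

variable {k R M N P}

/-- The map `r ⊗ m ↦ r m`. -/
def lidHom : BimodTensor k R (UnitBimod k R) M →ₗ[Envelope k R] M :=
  Envelope.linearMap
    (lift (fun (r : UnitBimod k R) m => Envelope.left k r.val • m)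
      (fun r r' m => by
        rw [← add_smul, ← TensorProduct.add_tmul]; rfl)
      (fun r m m' => smul_add _ _ _)
      (fun s r m => by
        rw [UnitBimod.smul_eq, smul_smul]
        simp))
    (fun r r' z => by
      induction z using induction_on with
      | add x y hx hy => rw [smul_add, map_add, map_add, smul_add, hx, hy]
      | tmul s m =>
        rw [smul_tmul', UnitBimod.smul_eq]
        simp [smul_smul])

/-- The map `m ⊗ r ↦ m r`. -/
def ridHom : BimodTensor k R M (UnitBimod k R) →ₗ[Envelope k R] M :=
  Envelope.linearMap
    (lift (fun m (r : UnitBimod k R) => Envelope.right k r.val • m)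
      (fun m m' r => smul_add _ _ _)
      (fun m r r' => by
        rw [← add_smul, ← TensorProduct.tmul_add, ← MulOpposite.op_add]; rfl)
      (fun s m r => by
        rw [UnitBimod.smul_eq, smul_smul]
        simp
        rfl))
    (fun r r' z => by
      induction z using induction_on with
      | add x y hx hy => rw [smul_add, map_add, map_add, smul_add, hx, hy]
      | tmul m s =>
        rw [smul_tmul', UnitBimod.smul_eq]
        simp [smul_smul])

@[simp] lemma lidHom_tmul (r : UnitBimod k R) (m : M) :
    lidHom (tmul k R r m) = Envelope.left k r.val • m := rfl

@[simp] lemma ridHom_tmul (r : UnitBimod k R) (m : M) :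
    ridHom (tmul k R m r) = Envelope.right k r.val • m := rfl

lemma left_one_smul (m : M) : Envelope.left k (1 : R) • m = m := one_smul (Envelope k R) m

lemma right_one_smul (m : M) : Envelope.right k (1 : R) • m = m := one_smul (Envelope k R) m

/-- The isomorphism `R ⊗_R M ≃ M`. -/
def lid : BimodTensor k R (UnitBimod k R) M ≃ₗ[Envelope k R] M :=
  { lidHom with
    invFun m := tmul k R (UnitBimod.of k (1 : R)) m
    left_inv z := by
      change tmul k R (UnitBimod.of k (1 : R)) (lidHom z) = z
      induction z using induction_on with
      | add x y hx hy => rw [map_add, tmul_add, hx, hy]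
      | tmul r m => rw [lidHom_tmul, ← smul_tmul, UnitBimod.right_smul_one]
    right_inv m := left_one_smul m }

/-- The isomorphism `M ⊗_R R ≃ M`. -/
def rid : BimodTensor k R M (UnitBimod k R) ≃ₗ[Envelope k R] M :=
  { ridHom with
    invFun m := tmul k R m (UnitBimod.of k (1 : R))
    left_inv z := by
      change tmul k R (ridHom z) (UnitBimod.of k (1 : R)) = z
      induction z using induction_on with
      | add x y hx hy => rw [map_add, add_tmul, hx, hy]
      | tmul m r => rw [ridHom_tmul, smul_tmul, UnitBimod.left_smul_one]
    right_inv m := right_one_smul m }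

end BimodTensor

/-- The category of `R`-bimodules over `k`, that is, of left `Rᵉ`-modules. -/
abbrev BimodCat (k : Type w) [CommRing k] (R : Type w) [Ring R] [Algebra k R] :=
  ModuleCat.{w} (Envelope k R)

namespace BimodCat

instance : MonoidalCategoryStruct (BimodCat k R) where
  tensorObj M N := ModuleCat.of _ (BimodTensor k R M N)
  whiskerLeft _ _ _ f := ModuleCat.ofHom (BimodTensor.map LinearMap.id f.hom)
  whiskerRight f _ := ModuleCat.ofHom (BimodTensor.map f.hom LinearMap.id)
  tensorHom f g := ModuleCat.ofHom (BimodTensor.map f.hom g.hom)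
  tensorUnit := ModuleCat.of _ (UnitBimod k R)
  associator M N P := (BimodTensor.assoc :
      BimodTensor k R (BimodTensor k R M N) P ≃ₗ[Envelope k R] _).toModuleIso
  leftUnitor M := (BimodTensor.lid : BimodTensor k R (UnitBimod k R) M ≃ₗ[Envelope k R] M).toModuleIso
  rightUnitor M := (BimodTensor.rid : BimodTensor k R M (UnitBimod k R) ≃ₗ[Envelope k R] M).toModuleIso

/-- The monoidal category of `R`-bimodules, with monoidal product `⊗_R` and unit `R`. -/
instance : MonoidalCategory (BimodCat k R) :=
  MonoidalCategory.ofTensorHom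
    (id_tensorHom_id := fun _ _ => ModuleCat.hom_ext (BimodTensor.linearMap_ext fun _ _ => rfl))
    (id_tensorHom := fun _ _ _ _ => rfl)
    (tensorHom_id := fun _ _ => rfl)
    (tensorHom_comp_tensorHom := fun _ _ _ _ =>
      ModuleCat.hom_ext (BimodTensor.linearMap_ext fun _ _ => rfl))
    (associator_naturality := fun _ _ _ =>
      ModuleCat.hom_ext (BimodTensor.linearMap_ext_left fun _ _ _ => rfl))
    (leftUnitor_naturality := fun f =>
      ModuleCat.hom_ext (BimodTensor.linearMap_ext fun r m => (f.hom.map_smul _ m).symm))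
    (rightUnitor_naturality := fun f =>
      ModuleCat.hom_ext (BimodTensor.linearMap_ext fun m r => (f.hom.map_smul _ m).symm))
    (pentagon := fun W X Y Z => by
      apply ModuleCat.hom_ext
      apply BimodTensor.linearMap_ext_left
      intro z y z'
      induction z using BimodTensor.induction_on with
      | tmul w x => rfl
      | add x y hx hy =>
        rw [BimodTensor.add_tmul, BimodTensor.add_tmul, map_add, map_add, hx, hy])
    (triangle := fun X Y => ModuleCat.hom_ext (BimodTensor.linearMap_ext_left fun m r n =>
      (BimodTensor.smul_tmul (k := k) (UnitBimod.val (k := k) (R := R) r) m n).symm))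

variable {k R} in
/-- The class `m ⊗ n` in the monoidal product of two bimodules. -/
def tmul {M N : BimodCat k R} (m : M) (n : N) : (M ⊗ N : BimodCat k R) :=
  BimodTensor.tmul k R m n

section

variable {k R} {M N M' N' P : BimodCat k R}

lemma add_tmul (m m' : M) (n : N) : tmul (m + m') n = tmul m n + tmul m' n :=
  BimodTensor.add_tmul m m' n

lemma tmul_add (m : M) (n n' : N) : tmul m (n + n') = tmul m n + tmul m n' :=
  BimodTensor.tmul_add m n n'

@[simp] lemma tensorHom_tmul (f : M ⟶ M') (g : N ⟶ N') (m : M) (n : N) :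
    (f ⊗ₘ g).hom (tmul m n) = tmul (f.hom m) (g.hom n) := rfl

@[elab_as_elim]
lemma induction_on {C : (M ⊗ N : BimodCat k R) → Prop} (z : (M ⊗ N : BimodCat k R))
    (tmul : ∀ m n, C (tmul m n)) (add : ∀ x y, C x → C y → C (x + y)) : C z :=
  BimodTensor.induction_on z tmul add

/-- An additive bijection commuting with the action of pure tensors is an isomorphism. -/
def isoOfAddEquiv (φ : M ≃+ N) (h : ∀ (r : R) (r' : Rᵐᵒᵖ) (m : M),
    φ ((r ⊗ₜ[k] r' : Envelope k R) • m) = (r ⊗ₜ[k] r' : Envelope k R) • φ m) : M ≅ N :=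
  LinearEquiv.toModuleIso
    { Envelope.linearMap φ.toAddMonoidHom h with
      invFun := φ.symm
      left_inv := φ.left_inv
      right_inv := φ.right_inv }

end

end BimodCat

end Bimodules

section Bialgebroids

/-- A `k`-algebra `A` with a source map `s : R → A` and a target map `t : Rᵒᵖ → A`, which are
morphisms of `k`-algebras with commuting images. -/
structure SourceTarget (k : Type w) [CommRing k] (R : Type w) [Ring R] [Algebra k R]
    (A : Type w) [Ring A] [Algebra k A] where
  /-- the source map -/
  s : R →ₐ[k] A
  /-- the target map -/
  t : Rᵐᵒᵖ →ₐ[k] A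
  commute : ∀ (r : R) (r' : Rᵐᵒᵖ), Commute (s r) (t r')

variable {k : Type w} [CommRing k] {R : Type w} [Ring R] [Algebra k R]
  {A : Type w} [Ring A] [Algebra k A]

namespace SourceTarget

variable (X : SourceTarget k R A)

/-- The algebra morphism `e : Rᵉ → A`, `r ⊗ r' ↦ s r * t r'`. -/
def e : Envelope k R →ₐ[k] A := Algebra.TensorProduct.lift X.s X.t X.commute

lemma e_tmul (r : R) (r' : Rᵐᵒᵖ) : X.e (r ⊗ₜ[k] r') = X.s r * X.t r' := rfl

/-- Every left `A`-module is an `R`-bimodule through `e`. -/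
abbrev res : ModuleCat.{w} A ⥤ BimodCat k R := ModuleCat.restrictScalars X.e.toRingHom

/-- The bimodule `ₑA`. -/
abbrev regular : BimodCat k R := X.res.obj (ModuleCat.of A A)

/-- An element of `A` regarded as an element of `ₑA`. -/
def toRegular (a : A) : X.regular := a

/-- The morphism of bimodules `ₑA ⟶ M`, `a ↦ a • m`, for an element `m` of an `A`-module `M`.
For `M = A` this is right multiplication by `m`. -/
def orbit {M : ModuleCat.{w} A} (m : X.res.obj M) : X.regular ⟶ X.res.obj M :=
  X.res.map (ModuleCat.ofHom (LinearMap.toSpanSingleton A M m))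

/-- Right multiplication by an element of `A`. -/
def rightMul (a : A) : X.regular ⟶ X.regular := X.orbit (X.toRegular a)

/-- The Takeuchi product `A ×_R A`: the elements `∑ aᵢ ⊗ bᵢ` of `ₑA ⊗_R ₑA` such that
`∑ aᵢ t(r) ⊗ bᵢ = ∑ aᵢ ⊗ bᵢ s(r)` for all `r` in `R`. -/
def takeuchi : AddSubgroup (X.regular ⊗ X.regular : BimodCat k R) where
  carrier := {u | ∀ r : R, (X.rightMul (X.t (op r)) ▷ X.regular).hom u =
    (X.regular ◁ X.rightMul (X.s r)).hom u}
  zero_mem' r := by rw [map_zero, map_zero]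
  add_mem' hu hv r := by rw [map_add, map_add, hu r, hv r]
  neg_mem' hu r := by rw [map_neg, map_neg, hu r]

variable {M N M' N' : ModuleCat.{w} A}

lemma orbit_apply (m : X.res.obj M) (a : A) :
    (X.orbit m).hom (X.toRegular a) = (show M from a • (show M from m)) := rfl

lemma orbit_add (m m' : X.res.obj M) : X.orbit (m + m') = X.orbit m + X.orbit m' := by
  ext a
  exact smul_add (show A from a) (show M from m) (show M from m')

lemma orbit_right_smul (r : R) (m : X.res.obj M) :
    X.orbit (Envelope.right k r • m) = X.rightMul (X.t (op r)) ≫ X.orbit m := by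
  ext b
  change (show A from b) • (X.e (Envelope.right k r) • (show M from m)) =
    ((show A from b) * X.t (op r)) • (show M from m)
  rw [X.e_tmul, map_one, one_mul, mul_smul]

lemma orbit_left_smul (r : R) (m : X.res.obj M) :
    X.orbit (Envelope.left k r • m) = X.rightMul (X.s r) ≫ X.orbit m := by
  ext b
  change (show A from b) • (X.e (Envelope.left k r) • (show M from m)) =
    ((show A from b) * X.s r) • (show M from m)
  rw [X.e_tmul, map_one, mul_one, mul_smul]

lemma tensorHom_add_left {P Q P' Q' : BimodCat k R} (f f' : P ⟶ P') (g : Q ⟶ Q')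
    (u : (P ⊗ Q : BimodCat k R)) :
    ((f + f') ⊗ₘ g).hom u = (f ⊗ₘ g).hom u + (f' ⊗ₘ g).hom u := by
  induction u using BimodCat.induction_on with
  | tmul p q => exact BimodCat.add_tmul _ _ _
  | add x y hx hy => rw [map_add, map_add, map_add, hx, hy]; abel

lemma tensorHom_add_right {P Q P' Q' : BimodCat k R} (f : P ⟶ P') (g g' : Q ⟶ Q')
    (u : (P ⊗ Q : BimodCat k R)) :
    (f ⊗ₘ (g + g')).hom u = (f ⊗ₘ g).hom u + (f ⊗ₘ g').hom u := by
  induction u using BimodCat.induction_on with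
  | tmul p q => exact BimodCat.tmul_add _ _ _
  | add x y hx hy => rw [map_add, map_add, map_add, hx, hy]; abel

/-- The action `(∑ aᵢ ⊗ bᵢ) · (m ⊗ n) = ∑ aᵢ m ⊗ bᵢ n` of the Takeuchi product on the tensor product
over `R` of two `A`-modules. For `M = N = A` it extends the product
`(a ⊗ b)(a' ⊗ b') = a a' ⊗ b b'` of `A ×_R A`. -/
def act (u : X.takeuchi) : (X.res.obj M ⊗ X.res.obj N : BimodCat k R) →+
    (X.res.obj M ⊗ X.res.obj N : BimodCat k R) :=
  BimodTensor.lift (fun m n => (X.orbit m ⊗ₘ X.orbit n).hom u.1)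
    (fun m m' n => by rw [X.orbit_add, tensorHom_add_left])
    (fun m n n' => by rw [X.orbit_add, tensorHom_add_right])
    (fun r m n => by
      have h₃ : (X.rightMul (X.t (op r)) ≫ X.orbit m) ⊗ₘ X.orbit n =
          (X.rightMul (X.t (op r)) ▷ X.regular) ≫ (X.orbit m ⊗ₘ X.orbit n) := by
        rw [← tensorHom_id, tensorHom_comp_tensorHom, Category.id_comp]
      have h₄ : X.orbit m ⊗ₘ (X.rightMul (X.s r) ≫ X.orbit n) =
          (X.regular ◁ X.rightMul (X.s r)) ≫ (X.orbit m ⊗ₘ X.orbit n) := by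
        rw [← id_tensorHom, tensorHom_comp_tensorHom, Category.id_comp]
      rw [X.orbit_right_smul, X.orbit_left_smul, h₃, h₄, ModuleCat.hom_comp, ModuleCat.hom_comp,
        LinearMap.comp_apply, LinearMap.comp_apply, u.2 r])

@[simp] lemma act_tmul (u : X.takeuchi) (m : X.res.obj M) (n : X.res.obj N) :
    X.act u (BimodCat.tmul m n) = (X.orbit m ⊗ₘ X.orbit n).hom u.1 := rfl

/-- The comultiplication of a coalgebra structure on `ₑA` as a function. -/
def comul (c : ComonObj X.regular) (a : A) : (X.regular ⊗ X.regular : BimodCat k R) :=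
  c.comul.hom (X.toRegular a)

/-- The counit of a coalgebra structure on `ₑA` as a function. -/
def counit (c : ComonObj X.regular) (a : A) : R :=
  UnitBimod.val (k := k) (R := R) (c.counit.hom (X.toRegular a))

end SourceTarget

/-- A left bialgebroid (Takeuchi `×_R`-bialgebra) `A` with base `R` over `k`. -/
structure LeftBialgebroid (k : Type w) [CommRing k] (R : Type w) [Ring R] [Algebra k R]
    (A : Type w) [Ring A] [Algebra k A] extends SourceTarget k R A where
  /-- `(ₑA, Δ, ε)` is a coalgebra in the monoidal category of `R`-bimodules. -/
  coalgebra : ComonObj toSourceTarget.regular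
  /-- `Δ` takes its values in `A ×_R A`. -/
  comul_mem : ∀ a : A, toSourceTarget.comul coalgebra a ∈ toSourceTarget.takeuchi
  /-- `Δ(1) = 1 ⊗ 1` -/
  comul_one : toSourceTarget.comul coalgebra 1 =
    BimodCat.tmul (toSourceTarget.toRegular 1) (toSourceTarget.toRegular 1)
  /-- `Δ(ab) = Δ(a)Δ(b)` -/
  comul_mul : ∀ a b : A, toSourceTarget.comul coalgebra (a * b) =
    toSourceTarget.act (M := ModuleCat.of A A) (N := ModuleCat.of A A)
      ⟨toSourceTarget.comul coalgebra a, comul_mem a⟩ (toSourceTarget.comul coalgebra b)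
  /-- `ε(a s(ε(a'))) = ε(aa')` -/
  counit_mul_source : ∀ a a' : A,
    toSourceTarget.counit coalgebra (a * s (toSourceTarget.counit coalgebra a')) =
      toSourceTarget.counit coalgebra (a * a')
  /-- `ε(a t(ε(a'))) = ε(aa')` -/
  counit_mul_target : ∀ a a' : A,
    toSourceTarget.counit coalgebra (a * t (op (toSourceTarget.counit coalgebra a'))) =
      toSourceTarget.counit coalgebra (a * a')
  /-- `ε(1) = 1` -/
  counit_one : toSourceTarget.counit coalgebra 1 = 1

namespace LeftBialgebroid

open SourceTarget

variable (H : LeftBialgebroid k R A)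

/-- The value of the comultiplication at `a`, in the Takeuchi product. -/
def Δ (a : A) : H.takeuchi := ⟨H.comul H.coalgebra a, H.comul_mem a⟩

/-- The counit `A → R`. -/
def ε (a : A) : R := H.counit H.coalgebra a

/-! ### Tensor products of modules over a left bialgebroid -/

variable {M N P M' N' : ModuleCat.{w} A}

variable (M N) in
/-- The abelian group `M ⊗_R N` underlying the tensor product of two `A`-modules. -/
def Tensor : Type w := (H.res.obj M ⊗ H.res.obj N : BimodCat k R)

instance : AddCommGroup (H.Tensor M N) :=
  inferInstanceAs (AddCommGroup (H.res.obj M ⊗ H.res.obj N : BimodCat k R))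

lemma act_add (u v : H.takeuchi) : H.act (M := M) (N := N) (u + v) = H.act u + H.act v := by
  ext z
  induction z using BimodCat.induction_on with
  | tmul m n => exact map_add (H.orbit m ⊗ₘ H.orbit n).hom u.1 v.1
  | add x y hx hy => rw [map_add, map_add, hx, hy]

/-- The action of the Takeuchi product is natural in `A`-linear maps. -/
lemma act_natural (f : M ⟶ M') (g : N ⟶ N') (u : H.takeuchi)
    (z : (H.res.obj M ⊗ H.res.obj N : BimodCat k R)) :
    (H.res.map f ⊗ₘ H.res.map g).hom (H.act u z) =
      H.act u ((H.res.map f ⊗ₘ H.res.map g).hom z) := by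
  induction z using BimodCat.induction_on with
  | add x y hx hy => rw [map_add, map_add, map_add, map_add, hx, hy]
  | tmul m n =>
    have h₁ : H.orbit ((H.res.map f).hom m) = H.orbit m ≫ H.res.map f := by
      ext a
      exact (f.hom.map_smul (show A from a) (show M from m)).symm
    have h₂ : H.orbit ((H.res.map g).hom n) = H.orbit n ≫ H.res.map g := by
      ext a
      exact (g.hom.map_smul (show A from a) (show N from n)).symm
    rw [BimodCat.tensorHom_tmul, act_tmul, act_tmul, h₁, h₂, ← tensorHom_comp_tensorHom]
    rfl

lemma Δ_one : (H.Δ 1).1 = BimodCat.tmul (H.toRegular 1) (H.toRegular 1) := H.comul_one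

lemma Δ_add (a b : A) : H.Δ (a + b) = H.Δ a + H.Δ b :=
  Subtype.ext (map_add H.coalgebra.comul.hom (H.toRegular a) (H.toRegular b))

lemma Δ_mul (a b : A) : (H.Δ (a * b)).1 =
    H.act (M := ModuleCat.of A A) (N := ModuleCat.of A A) (H.Δ a) (H.Δ b).1 := H.comul_mul a b

lemma act_one (z : (H.res.obj M ⊗ H.res.obj N : BimodCat k R)) : H.act (H.Δ 1) z = z := by
  induction z using BimodCat.induction_on with
  | add x y hx hy => rw [map_add, hx, hy]
  | tmul m n =>
    rw [act_tmul, Δ_one, BimodCat.tensorHom_tmul, orbit_apply, orbit_apply]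
    congr 1
    · exact one_smul A (show M from m)
    · exact one_smul A (show N from n)

lemma act_mul (a b : A) (z : (H.res.obj M ⊗ H.res.obj N : BimodCat k R)) :
    H.act (H.Δ (a * b)) z = H.act (H.Δ a) (H.act (H.Δ b) z) := by
  induction z using BimodCat.induction_on with
  | add x y hx hy => rw [map_add, map_add, map_add, hx, hy]
  | tmul m n =>
    rw [act_tmul, act_tmul, Δ_mul]
    exact act_natural H (ModuleCat.ofHom (LinearMap.toSpanSingleton A M m))
      (ModuleCat.ofHom (LinearMap.toSpanSingleton A N n)) _ _

/-- The action `a • (m ⊗ n) = ∑ a₁ m ⊗ a₂ n` on `M ⊗_R N`, where `Δ(a) = ∑ a₁ ⊗ a₂`. -/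
instance : Module A (H.Tensor M N) where
  smul a z := H.act (H.Δ a) z
  one_smul z := H.act_one z
  mul_smul a b z := H.act_mul a b z
  smul_zero a := map_zero (H.act (H.Δ a))
  smul_add a := map_add (H.act (H.Δ a))
  zero_smul z := by
    have h : H.Δ 0 + H.Δ 0 = H.Δ 0 := by rw [← Δ_add, add_zero]
    change H.act (H.Δ 0) z = 0
    rw [add_eq_left.mp h]
    have h' : H.act (M := M) (N := N) 0 + H.act 0 = H.act 0 := by rw [← act_add, add_zero]
    rw [add_eq_left.mp h']
    rfl
  add_smul a b z := by
    change H.act (H.Δ (a + b)) z = H.act (H.Δ a) z + H.act (H.Δ b) z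
    rw [Δ_add, act_add]
    rfl

lemma Δ_source (r : R) : (H.Δ (H.s r)).1 =
    BimodCat.tmul (H.toRegular (H.s r)) (H.toRegular 1) := by
  have h := H.coalgebra.comul.hom.map_smul (Envelope.left k r) (H.toRegular 1)
  have h₁ : Envelope.left k r • H.toRegular 1 = H.toRegular (H.s r) := by
    change H.e (Envelope.left k r) * 1 = H.s r
    rw [e_tmul, map_one, mul_one, mul_one]
  rw [h₁] at h
  refine h.trans ?_
  have h₂ := H.comul_one
  unfold SourceTarget.comul at h₂
  rw [h₂, ← h₁]
  exact BimodTensor.left_smul_tmul r (H.toRegular 1) (H.toRegular 1)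

lemma Δ_target (r : R) : (H.Δ (H.t (op r))).1 =
    BimodCat.tmul (H.toRegular 1) (H.toRegular (H.t (op r))) := by
  have h := H.coalgebra.comul.hom.map_smul (Envelope.right k r) (H.toRegular 1)
  have h₁ : Envelope.right k r • H.toRegular 1 = H.toRegular (H.t (op r)) := by
    change H.e (Envelope.right k r) * 1 = H.t (op r)
    rw [e_tmul, map_one, one_mul, mul_one]
  rw [h₁] at h
  refine h.trans ?_
  have h₂ := H.comul_one
  unfold SourceTarget.comul at h₂
  rw [h₂, ← h₁]
  exact BimodTensor.right_smul_tmul r (H.toRegular 1) (H.toRegular 1)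

lemma orbit_one : H.orbit (H.toRegular 1) = 𝟙 H.regular := by
  ext a
  exact mul_one (show A from a)

lemma source_comul (r : R) : H.rightMul (H.s r) ≫ H.coalgebra.comul =
    H.coalgebra.comul ≫ (H.rightMul (H.s r) ▷ H.regular) := by
  ext a
  refine (H.Δ_mul (show A from a) (H.s r)).trans ?_
  rw [Δ_source, act_tmul, orbit_one, tensorHom_id]
  rfl

lemma target_comul (r : R) : H.rightMul (H.t (op r)) ≫ H.coalgebra.comul =
    H.coalgebra.comul ≫ (H.regular ◁ H.rightMul (H.t (op r))) := by
  ext a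
  refine (H.Δ_mul (show A from a) (H.t (op r))).trans ?_
  rw [Δ_target, act_tmul, orbit_one, id_tensorHom]
  rfl

lemma ε_add (a b : A) : H.ε (a + b) = H.ε a + H.ε b :=
  map_add H.coalgebra.counit.hom (H.toRegular a) (H.toRegular b)

lemma ε_one : H.ε 1 = 1 := H.counit_one

lemma ε_mul_source (a b : A) : H.ε (a * H.s (H.ε b)) = H.ε (a * b) := H.counit_mul_source a b

lemma ε_mul_target (a b : A) : H.ε (a * H.t (op (H.ε b))) = H.ε (a * b) :=
  H.counit_mul_target a b

lemma ε_e_mul (r : R) (r' : Rᵐᵒᵖ) (a : A) :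
    H.ε (H.e (r ⊗ₜ[k] r') * a) = r * (H.ε a * unop r') := by
  have h := H.coalgebra.counit.hom.map_smul (r ⊗ₜ[k] r' : Envelope k R) (H.toRegular a)
  exact (congrArg (UnitBimod.val (k := k) (R := R)) h).trans
    (congrArg (UnitBimod.val (k := k) (R := R))
      (UnitBimod.smul_eq r r' (H.coalgebra.counit.hom (H.toRegular a))))

lemma ε_source (r : R) : H.ε (H.s r) = r := by
  have h := H.ε_e_mul r 1 1
  rwa [e_tmul, map_one, mul_one, mul_one, ε_one, unop_one, mul_one, mul_one] at h

lemma ε_target (r : R) : H.ε (H.t (op r)) = r := by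
  have h := H.ε_e_mul 1 (op r) 1
  rwa [e_tmul, map_one, mul_one, one_mul, ε_one, unop_op, one_mul, one_mul] at h

/-- The base ring `R`, regarded as a left `A`-module. -/
def UnitModule (_ : LeftBialgebroid k R A) : Type w := R

instance : AddCommGroup H.UnitModule := inferInstanceAs (AddCommGroup R)

/-- The action `a • r = ε(a s(r))` of `A` on the unit object `R`. -/
instance : Module A H.UnitModule where
  smul a r := H.ε (a * H.s (show R from r))
  one_smul r := by
    change H.ε (1 * H.s (show R from r)) = r
    rw [one_mul, ε_source]
  mul_smul a b r := by
    change H.ε (a * b * H.s (show R from r)) = H.ε (a * H.s (H.ε (b * H.s (show R from r))))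
    rw [ε_mul_source, mul_assoc]
  smul_zero a := by
    change H.ε (a * H.s 0) = 0
    rw [map_zero, mul_zero]
    exact map_zero H.coalgebra.counit.hom
  smul_add a r r' := by
    change H.ε (a * H.s ((show R from r) + (show R from r'))) =
      H.ε (a * H.s (show R from r)) + H.ε (a * H.s (show R from r'))
    rw [map_add, mul_add, ε_add]
  zero_smul r := by
    change H.ε (0 * H.s (show R from r)) = 0
    rw [zero_mul]
    exact map_zero H.coalgebra.counit.hom
  add_smul a b r := by
    change H.ε ((a + b) * H.s (show R from r)) =
      H.ε (a * H.s (show R from r)) + H.ε (b * H.s (show R from r))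
    rw [add_mul, ε_add]

/-- The restriction of `M ⊗_R N` to `Rᵉ` is the tensor product of the bimodules `M` and `N`. -/
def tensorIso (M N : ModuleCat.{w} A) : (H.res.obj M ⊗ H.res.obj N : BimodCat k R) ≅
    H.res.obj (ModuleCat.of A (H.Tensor M N)) :=
  BimodCat.isoOfAddEquiv (M := H.res.obj M ⊗ H.res.obj N)
    (N := H.res.obj (ModuleCat.of A (H.Tensor M N))) (AddEquiv.refl _)
    (fun r r' z => by
      change r ⊗ₜ[k] r' • z = H.act (H.Δ (H.e (r ⊗ₜ[k] r'))) z
      rw [e_tmul, act_mul]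
      induction z using BimodCat.induction_on with
      | add x y hx hy => rw [smul_add, map_add, map_add, hx, hy]
      | tmul m n =>
        have h₁ : H.act (H.Δ (H.t r')) (BimodCat.tmul m n) =
            BimodCat.tmul m (Envelope.right k (unop r') • n) := by
          rw [act_tmul, ← op_unop r', Δ_target, BimodCat.tensorHom_tmul, orbit_apply,
            orbit_apply]
          congr 1
          · exact one_smul A (show M from m)
          · change _ = H.e (Envelope.right k (unop r')) • (show N from n)
            rw [e_tmul, map_one, one_mul]
        rw [h₁, act_tmul, Δ_source, BimodCat.tensorHom_tmul, orbit_apply, orbit_apply]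
        refine (BimodTensor.smul_tmul' r r' m n).trans ?_
        have h₂ : Envelope.left k r • m = (show M from H.s r • (show M from m)) := by
          change H.e (Envelope.left k r) • (show M from m) = _
          rw [e_tmul, map_one, mul_one]
        rw [h₂]
        congr 1
        exact (one_smul A (show N from Envelope.right k (unop r') • n)).symm)

/-- The restriction of the unit module to `Rᵉ` is the bimodule `R`. -/
def unitIso : (𝟙_ (BimodCat k R)) ≅ H.res.obj (ModuleCat.of A H.UnitModule) :=
  BimodCat.isoOfAddEquiv (M := 𝟙_ (BimodCat k R))
    (N := H.res.obj (ModuleCat.of A H.UnitModule)) (AddEquiv.refl R)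
    (fun r r' z => by
      refine (UnitBimod.smul_eq r r' z).trans ?_
      change r * (UnitBimod.val (k := k) (R := R) z * unop r') =
        H.ε (H.e (r ⊗ₜ[k] r') * H.s (UnitBimod.val (k := k) (R := R) z))
      rw [ε_e_mul, ε_source])

lemma orbit_tmul (m : H.res.obj M) (n : H.res.obj N) :
    H.orbit ((H.tensorIso M N).hom.hom (BimodCat.tmul m n)) =
      H.coalgebra.comul ≫ (H.orbit m ⊗ₘ H.orbit n) ≫ (H.tensorIso M N).hom := by
  ext a
  rfl

lemma orbit_unit (r : R) : H.orbit (H.unitIso.hom.hom (UnitBimod.of k r : UnitBimod k R)) =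
    H.rightMul (H.s r) ≫ H.coalgebra.counit ≫ H.unitIso.hom := by
  ext a
  rfl

lemma source_counit (r : R) : H.rightMul (H.s r) ≫ H.coalgebra.counit =
    H.rightMul (H.t (op r)) ≫ H.coalgebra.counit := by
  ext a
  change H.ε ((show A from a) * H.s r) = H.ε ((show A from a) * H.t (op r))
  have h := H.ε_mul_target (show A from a) (H.s r)
  rw [ε_source] at h
  exact h.symm

variable {X Y : ModuleCat.{w} A}

/-- An isomorphism of bimodules which commutes with the action of `A`. -/
def liftIso (φ : H.res.obj X ≅ H.res.obj Y)
    (h : ∀ x : H.res.obj X, H.orbit x ≫ φ.hom = H.orbit (φ.hom.hom x)) : X ≅ Y :=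
  LinearEquiv.toModuleIso
    { toFun := fun x => φ.hom.hom x
      map_add' := map_add φ.hom.hom
      map_smul' := fun a x => congrArg (fun f => f.hom (H.toRegular a)) (h x)
      invFun := fun y => φ.inv.hom y
      left_inv := fun x => congrArg (fun f => f.hom x) φ.hom_inv_id
      right_inv := fun x => congrArg (fun f => f.hom x) φ.inv_hom_id }

lemma res_map_liftIso (φ : H.res.obj X ≅ H.res.obj Y) (h) :
    H.res.map (H.liftIso φ h).hom = φ.hom := rfl

/-- The tensor product of two morphisms of `A`-modules. -/
def tensorMap (f : M ⟶ M') (g : N ⟶ N') :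
    ModuleCat.of A (H.Tensor M N) ⟶ ModuleCat.of A (H.Tensor M' N') :=
  ModuleCat.ofHom
    { toFun := (H.res.map f ⊗ₘ H.res.map g).hom
      map_add' := map_add (H.res.map f ⊗ₘ H.res.map g).hom
      map_smul' := fun a z => H.act_natural f g (H.Δ a) z }

lemma add_tensorHom_bimod {P Q P' Q' : BimodCat k R} (f f' : P ⟶ P') (g : Q ⟶ Q') :
    (f + f') ⊗ₘ g = (f ⊗ₘ g) + (f' ⊗ₘ g) :=
  ModuleCat.hom_ext (LinearMap.ext fun u => tensorHom_add_left f f' g u)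

lemma commutes_of_tmul (φ : H.res.obj (ModuleCat.of A (H.Tensor M N)) ⟶ H.res.obj Y)
    (h : ∀ (m : H.res.obj M) (n : H.res.obj N),
      H.coalgebra.comul ≫ (H.orbit m ⊗ₘ H.orbit n) ≫ (H.tensorIso M N).hom ≫ φ =
        H.orbit (φ.hom ((H.tensorIso M N).hom.hom (BimodCat.tmul m n))))
    (x : H.res.obj (ModuleCat.of A (H.Tensor M N))) : H.orbit x ≫ φ = H.orbit (φ.hom x) := by
  obtain ⟨z, rfl⟩ : ∃ z, (H.tensorIso M N).hom.hom z = x := ⟨x, rfl⟩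
  induction z using BimodCat.induction_on with
  | add z z' hz hz' =>
    rw [map_add, orbit_add, Preadditive.add_comp, hz, hz', map_add, orbit_add]
  | tmul m n => rw [← h, orbit_tmul, Category.assoc, Category.assoc]

/-- The associativity constraint `(M ⊗_R N) ⊗_R P ≅ M ⊗_R (N ⊗_R P)` of bimodules is `A`-linear. -/
def assocIso (M N P : ModuleCat.{w} A) :
    ModuleCat.of A (H.Tensor (ModuleCat.of A (H.Tensor M N)) P) ≅
      ModuleCat.of A (H.Tensor M (ModuleCat.of A (H.Tensor N P))) :=
  H.liftIso
    (((H.tensorIso _ _).symm ≪≫ ((H.tensorIso _ _).symm ⊗ᵢ .refl _)) ≪≫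
      α_ (H.res.obj M) (H.res.obj N) (H.res.obj P) ≪≫
      ((.refl _ ⊗ᵢ H.tensorIso _ _) ≪≫ H.tensorIso _ _))
    (H.commutes_of_tmul _ fun z p => by
      obtain ⟨z, rfl⟩ : ∃ z', (H.tensorIso M N).hom.hom z' = z := ⟨z, rfl⟩
      induction z using BimodCat.induction_on with
      | add z z' hz hz' =>
        have h := congrArg₂ (· + ·) hz hz'
        rw [← Preadditive.comp_add, ← Preadditive.add_comp, ← add_tensorHom_bimod, ← orbit_add,
          ← orbit_add, ← map_add, ← map_add, ← map_add, ← BimodCat.add_tmul] at h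
        exact h
      | tmul m n =>
        have h : H.orbit ((H.tensorIso M (ModuleCat.of A (H.Tensor N P))).hom.hom
            (BimodCat.tmul m ((H.tensorIso N P).hom.hom (BimodCat.tmul n p)))) =
            H.coalgebra.comul ≫ (H.orbit m ⊗ₘ (H.coalgebra.comul ≫ (H.orbit n ⊗ₘ H.orbit p) ≫
              (H.tensorIso N P).hom)) ≫ (H.tensorIso M (ModuleCat.of A (H.Tensor N P))).hom := by
          rw [orbit_tmul, orbit_tmul]
        refine Eq.trans ?_ h.symm
        rw [orbit_tmul]
        have h₁ := H.coalgebra.comul_assoc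
        have h₂ : (H.coalgebra.comul ≫ (H.orbit m ⊗ₘ H.orbit n) ≫ (H.tensorIso M N).hom) ⊗ₘ
            H.orbit p = (H.coalgebra.comul ▷ H.regular) ≫
              ((H.orbit m ⊗ₘ H.orbit n) ⊗ₘ H.orbit p) ≫ ((H.tensorIso M N).hom ▷ _) := by
          rw [← tensorHom_id, ← tensorHom_id, tensorHom_comp_tensorHom, tensorHom_comp_tensorHom,
            Category.id_comp, Category.comp_id]
        have h₃ : H.orbit m ⊗ₘ (H.coalgebra.comul ≫ (H.orbit n ⊗ₘ H.orbit p) ≫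
            (H.tensorIso N P).hom) = (H.regular ◁ H.coalgebra.comul) ≫
              (H.orbit m ⊗ₘ (H.orbit n ⊗ₘ H.orbit p)) ≫ (_ ◁ (H.tensorIso N P).hom) := by
          rw [← id_tensorHom, ← id_tensorHom, tensorHom_comp_tensorHom, tensorHom_comp_tensorHom,
            Category.id_comp, Category.comp_id]
        rw [h₂, h₃]
        simp only [Category.assoc, reassoc_of% h₁, Iso.trans_hom, Iso.symm_hom, tensorIso_hom,
          Iso.refl_hom, tensorHom_id, id_tensorHom, Iso.hom_inv_id_assoc,
          hom_inv_whiskerRight_assoc, associator_naturality_assoc])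

/-- The unit constraint `R ⊗_R M ≅ M` of bimodules is `A`-linear. -/
def leftUnitIso (M : ModuleCat.{w} A) :
    ModuleCat.of A (H.Tensor (ModuleCat.of A H.UnitModule) M) ≅ M :=
  H.liftIso (((H.tensorIso _ _).symm ≪≫ (H.unitIso.symm ⊗ᵢ .refl _)) ≪≫ λ_ (H.res.obj M))
    (H.commutes_of_tmul _ fun r m => by
      obtain ⟨r, rfl⟩ : ∃ r' : UnitBimod k R, H.unitIso.hom.hom r' = r := ⟨r, rfl⟩
      refine Eq.trans ?_ (H.orbit_left_smul (r.val) m).symm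
      rw [show H.orbit (H.unitIso.hom.hom r) = _ from H.orbit_unit r.val]
      have h₂ : (H.rightMul (H.s r.val) ≫ H.coalgebra.counit ≫ H.unitIso.hom) ⊗ₘ H.orbit m =
          (H.rightMul (H.s r.val) ▷ H.regular) ≫ (H.coalgebra.counit ▷ H.regular) ≫
            (_ ◁ H.orbit m) ≫ (H.unitIso.hom ▷ _) := by
        rw [← tensorHom_id, ← tensorHom_id, ← tensorHom_id, ← id_tensorHom,
          tensorHom_comp_tensorHom, tensorHom_comp_tensorHom, tensorHom_comp_tensorHom]
        simp only [Category.id_comp, Category.comp_id]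
      have h₃ := H.coalgebra.counit_comul
      rw [h₂]
      simp only [Category.assoc, ← reassoc_of% H.source_comul r.val, Iso.trans_hom, Iso.symm_hom,
        tensorIso_hom, Iso.refl_hom, tensorHom_id, Iso.hom_inv_id_assoc,
        hom_inv_whiskerRight_assoc, leftUnitor_naturality, reassoc_of% h₃, Iso.inv_hom_id_assoc])

/-- The unit constraint `M ⊗_R R ≅ M` of bimodules is `A`-linear. -/
def rightUnitIso (M : ModuleCat.{w} A) :
    ModuleCat.of A (H.Tensor M (ModuleCat.of A H.UnitModule)) ≅ M :=
  H.liftIso (((H.tensorIso _ _).symm ≪≫ (.refl _ ⊗ᵢ H.unitIso.symm)) ≪≫ ρ_ (H.res.obj M))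
    (H.commutes_of_tmul _ fun m r => by
      obtain ⟨r, rfl⟩ : ∃ r' : UnitBimod k R, H.unitIso.hom.hom r' = r := ⟨r, rfl⟩
      refine Eq.trans ?_ (H.orbit_right_smul (r.val) m).symm
      rw [show H.orbit (H.unitIso.hom.hom r) = _ from H.orbit_unit r.val,
        reassoc_of% H.source_counit r.val]
      have h₂ : H.orbit m ⊗ₘ (H.rightMul (H.t (op r.val)) ≫ H.coalgebra.counit ≫ H.unitIso.hom) =
          (H.regular ◁ H.rightMul (H.t (op r.val))) ≫ (H.regular ◁ H.coalgebra.counit) ≫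
            (H.orbit m ▷ _) ≫ (_ ◁ H.unitIso.hom) := by
        rw [← tensorHom_id, ← id_tensorHom, ← id_tensorHom, ← id_tensorHom,
          tensorHom_comp_tensorHom, tensorHom_comp_tensorHom, tensorHom_comp_tensorHom]
        simp only [Category.id_comp, Category.comp_id]
      have h₃ := H.coalgebra.comul_counit
      rw [h₂]
      simp only [Category.assoc, ← reassoc_of% H.target_comul r.val, Iso.trans_hom, Iso.symm_hom,
        tensorIso_hom, Iso.refl_hom, id_tensorHom, Iso.hom_inv_id_assoc,
        whiskerLeft_hom_inv_assoc, rightUnitor_naturality, reassoc_of% h₃, Iso.inv_hom_id_assoc])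

/-- The monoidal product `M ⊗_R N` of modules over a left bialgebroid, with unit `R`. -/
@[reducible]
def monoidalCategoryStruct : MonoidalCategoryStruct (ModuleCat.{w} A) where
  tensorObj M N := ModuleCat.of A (H.Tensor M N)
  whiskerLeft M _ _ g := H.tensorMap (𝟙 M) g
  whiskerRight f N := H.tensorMap f (𝟙 N)
  tensorHom f g := H.tensorMap f g
  tensorUnit := ModuleCat.of A H.UnitModule
  associator M N P := H.assocIso M N P
  leftUnitor M := H.leftUnitIso M
  rightUnitor M := H.rightUnitIso M

/-- The monoidal category of left modules over a left bialgebroid. -/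
@[reducible]
def monoidalCategory : MonoidalCategory (ModuleCat.{w} A) :=
  letI := H.monoidalCategoryStruct
  Monoidal.induced H.res
    { μIso := fun M N => H.tensorIso M N
      εIso := H.unitIso
      whiskerLeft_eq := fun M _ _ g => by
        rw [← id_tensorHom, ← H.res.map_id]; rfl
      whiskerRight_eq := fun f N => by
        rw [← tensorHom_id, ← H.res.map_id]; rfl
      tensorHom_eq := fun f g => rfl
      associator_eq := fun _ _ _ => rfl
      leftUnitor_eq := fun _ => rfl
      rightUnitor_eq := fun _ => rfl }

/-! ### The monad `T_A` and its left fusion operator -/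

/-- The abelian group `ₑAₑ ⊗_{Rᵉ} M` for a bimodule `M`. -/
def Induced (M : BimodCat k R) : Type w :=
  BalancedTensor (fun x : Envelope k R => AddMonoidHom.mulRight (H.e x))
    (fun x : Envelope k R => DistribSMul.toAddMonoidHom M x)

variable {V W : BimodCat k R}

instance : AddCommGroup (H.Induced V) := by
  unfold Induced; infer_instance

/-- The class `a ⊗ m` in `A ⊗_{Rᵉ} M`. -/
def indTmul (a : A) (m : V) : H.Induced V := BalancedTensor.tmul _ _ a m

lemma indTmul_smul (a : A) (x : Envelope k R) (m : V) :
    H.indTmul (a * H.e x) m = H.indTmul a (x • m) :=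
  BalancedTensor.tmul_balanced x a m

/-- The endomorphism `b ⊗ m ↦ ab ⊗ m`. -/
def indAct (a : A) : H.Induced V →+ H.Induced V :=
  BalancedTensor.lift (fun b m => H.indTmul (a * b) m)
    (fun b b' m => by rw [mul_add]; exact BalancedTensor.add_tmul _ _ _)
    (fun b m m' => BalancedTensor.tmul_add _ _ _)
    (fun x b m => by
      change H.indTmul (a * (b * H.e x)) m = H.indTmul (a * b) (x • m)
      rw [← mul_assoc, indTmul_smul])

lemma indAct_tmul (a b : A) (m : V) : H.indAct a (H.indTmul b m) = H.indTmul (a * b) m := rfl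

@[elab_as_elim]
lemma induced_induction {C : H.Induced V → Prop} (z : H.Induced V)
    (tmul : ∀ a m, C (H.indTmul a m)) (add : ∀ x y, C x → C y → C (x + y)) : C z :=
  BalancedTensor.induction_on z tmul add

/-- The action `a • (b ⊗ m) = ab ⊗ m`. -/
instance : Module A (H.Induced V) where
  smul a z := H.indAct a z
  one_smul z := by
    change H.indAct 1 z = z
    induction z using induced_induction with
    | tmul b m => rw [indAct_tmul, one_mul]
    | add x y hx hy => rw [map_add, hx, hy]
  mul_smul a b z := by
    change H.indAct (a * b) z = H.indAct a (H.indAct b z)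
    induction z using induced_induction with
    | tmul c m => rw [indAct_tmul, indAct_tmul, indAct_tmul, mul_assoc]
    | add x y hx hy => rw [map_add, map_add, map_add, hx, hy]
  smul_zero a := map_zero (H.indAct a)
  smul_add a := map_add (H.indAct a)
  zero_smul z := by
    change H.indAct 0 z = 0
    induction z using induced_induction with
    | tmul c m =>
      rw [indAct_tmul, zero_mul]
      have h : H.indTmul (0 + 0) m = H.indTmul 0 m + H.indTmul 0 m :=
        BalancedTensor.add_tmul _ _ _
      rw [add_zero] at h
      exact add_eq_left.mp h.symm
    | add x y hx hy => rw [map_add, hx, hy, add_zero]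
  add_smul a b z := by
    change H.indAct (a + b) z = H.indAct a z + H.indAct b z
    induction z using induced_induction with
    | tmul c m =>
      rw [indAct_tmul, indAct_tmul, indAct_tmul, add_mul]
      exact BalancedTensor.add_tmul _ _ _
    | add x y hx hy => rw [map_add, map_add, map_add, hx, hy]; abel

/-- The `A`-module `A ⊗_{Rᵉ} M` induced from a bimodule `M`. -/
abbrev induced (V : BimodCat k R) : ModuleCat.{w} A := ModuleCat.of A (H.Induced V)

/-- The bimodule `T_A(M) = ₑAₑ ⊗_{Rᵉ} M`. -/
abbrev monadObj (V : BimodCat k R) : BimodCat k R := H.res.obj (H.induced V)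

/-- The unit `M ⟶ T_A(M)`, `m ↦ 1 ⊗ m`, of the monad `T_A`. -/
def monadUnit (V : BimodCat k R) : V ⟶ H.monadObj V :=
  ModuleCat.ofHom (Y := H.monadObj V)
    { toFun := fun m => H.indTmul 1 m
      map_add' := fun m m' => BalancedTensor.tmul_add _ _ _
      map_smul' := fun x m => by
        change H.indTmul 1 (x • m) = H.indAct (H.e x) (H.indTmul 1 m)
        rw [indAct_tmul, ← indTmul_smul, one_mul, mul_one] }

/-- The left fusion operator `H^l_{M,N} : T_A(M ⊗_R T_A(N)) → T_A(M) ⊗_R T_A(N)` of the bimonad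
`T_A`: it maps `a ⊗ (m ⊗ (b ⊗ n))` to `Δ(a) · ((1 ⊗ m) ⊗ (b ⊗ n)) = ∑ (a₁ ⊗ m) ⊗ (a₂ b ⊗ n)`. -/
def leftFusion (V W : BimodCat k R) :
    H.Induced (V ⊗ H.monadObj W) →+ H.Tensor (H.induced V) (H.induced W) :=
  BalancedTensor.lift
    (fun a z => a • (show H.Tensor (H.induced V) (H.induced W) from
      (H.monadUnit V ▷ H.monadObj W ≫ (H.tensorIso (H.induced V) (H.induced W)).hom).hom z))
    (fun a a' z => add_smul a a' _)
    (fun a z z' => by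
      rw [map_add]
      exact smul_add a (_ : H.Tensor (H.induced V) (H.induced W)) _)
    (fun x a z => by
      have h := (H.monadUnit V ▷ H.monadObj W ≫
        (H.tensorIso (H.induced V) (H.induced W)).hom).hom.map_smul x z
      change (a * H.e x) • (show H.Tensor (H.induced V) (H.induced W) from
        (H.monadUnit V ▷ H.monadObj W ≫
          (H.tensorIso (H.induced V) (H.induced W)).hom).hom z) =
        a • (show H.Tensor (H.induced V) (H.induced W) from
          (H.monadUnit V ▷ H.monadObj W ≫
            (H.tensorIso (H.induced V) (H.induced W)).hom).hom (x • z))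
      rw [h, mul_smul]
      rfl)

lemma leftFusion_tmul (a b : A) (m : V) (n : W) :
    H.leftFusion V W (H.indTmul a (BimodCat.tmul m (show H.monadObj W from H.indTmul b n))) =
      H.act (M := H.induced V) (N := H.induced W) (H.Δ a)
        (BimodCat.tmul (show H.monadObj V from H.indTmul 1 m)
          (show H.monadObj W from H.indTmul b n)) := rfl

/-- A left Hopf algebroid is a left bialgebroid `A` whose bimonad `T_A` is a left Hopf monad, that
is, whose left fusion operator is invertible. -/
def IsLeftHopf : Prop := ∀ V W : BimodCat k R, Function.Bijective (H.leftFusion V W)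

end LeftBialgebroid

end Bialgebroids

section FiniteDimensional

open scoped ModuleCat

/-- Finite-dimensional left modules over a `k`-algebra `A`, as a property of `A`-modules. -/
def isFiniteDimensional (k : Type w) [Field k] (A : Type w) [Ring A] [Algebra k A] :
    ObjectProperty (ModuleCat.{w} A) :=
  fun M => Module.Finite k M

/-- The category of finite-dimensional left modules over a `k`-algebra `A`. -/
abbrev FDModCat (k : Type w) [Field k] (A : Type w) [Ring A] [Algebra k A] :=
  (isFiniteDimensional k A).FullSubcategory

/-- A `k`-linear category is finite if it is `k`-linearly equivalent to the category of
finite-dimensional left modules over a finite-dimensional `k`-algebra. -/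
def IsFiniteLinearCategory (k : Type w) [Field k] (C : Type u) [Category.{v} C] [Preadditive C]
    [Linear k C] : Prop :=
  ∃ (S : Type w) (_ : Ring S) (_ : Algebra k S) (_ : Module.Finite k S) (E : C ≌ FDModCat k S),
    E.functor.Additive ∧ E.functor.Linear k

namespace LeftBialgebroid

variable {k : Type w} [Field k] {R : Type w} [Ring R] [Algebra k R]
  {A : Type w} [Ring A] [Algebra k A] (H : LeftBialgebroid k R A)

lemma algebraMap_eq (c : k) : algebraMap k A c = H.e (Envelope.left k (algebraMap k R c)) := by
  rw [SourceTarget.e_tmul, map_one, mul_one, AlgHom.commutes]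

lemma finite_of_bilinear {M N Q : ModuleCat.{w} A} (hM : isFiniteDimensional k A M)
    (hN : isFiniteDimensional k A N) (f : M → N → Q)
    (h₁ : ∀ m m' n, f (m + m') n = f m n + f m' n)
    (h₂ : ∀ m n n', f m (n + n') = f m n + f m n')
    (h₃ : ∀ (c : k) m n, f (algebraMap k A c • m) n = algebraMap k A c • f m n)
    (h₄ : ∀ (c : k) m n, f m (algebraMap k A c • n) = algebraMap k A c • f m n)
    (h : ∀ S : AddSubmonoid Q, (∀ m n, f m n ∈ S) → ∀ q, q ∈ S) : isFiniteDimensional k A Q := by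
  have hM' : Module.Finite k M := hM
  have hN' : Module.Finite k N := hN
  let g : M →ₗ[k] N →ₗ[k] Q := LinearMap.mk₂ k f h₁ h₃ h₂ h₄
  refine Module.Finite.of_surjective (TensorProduct.lift g) fun z => ?_
  exact h (AddMonoidHom.mrange (TensorProduct.lift g).toAddMonoidHom)
    (fun m n => ⟨m ⊗ₜ[k] n, rfl⟩) z

lemma finite_unit [Module.Finite k R] : isFiniteDimensional k A (ModuleCat.of A H.UnitModule) := by
  let _ : Module k H.UnitModule :=
    ModuleCat.moduleOfAlgebraModule (ModuleCat.of A H.UnitModule)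
  let f : R →ₗ[k] H.UnitModule :=
    { toFun := fun r => r
      map_add' := fun _ _ => rfl
      map_smul' := fun c r => by
        change c • r = H.ε (algebraMap k A c * H.s r)
        rw [H.algebraMap_eq, ε_e_mul, ε_source, Algebra.smul_def, unop_one, mul_one] }
  exact Module.Finite.of_surjective f fun r => ⟨r, rfl⟩

lemma finite_tensor (M N : ModuleCat.{w} A) (hM : isFiniteDimensional k A M)
    (hN : isFiniteDimensional k A N) :
    isFiniteDimensional k A (ModuleCat.of A (H.Tensor M N)) := by
  have e (c : k) : algebraMap k A c = H.e (Envelope.right k (algebraMap k R c)) := by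
    rw [SourceTarget.e_tmul, map_one, one_mul]
    exact (H.t.commutes c).symm
  refine finite_of_bilinear hM hN (Q := ModuleCat.of A (H.Tensor M N))
    (fun m n => (H.tensorIso M N).hom.hom
        (BimodCat.tmul (M := H.res.obj M) (N := H.res.obj N) m n))
    (fun m m' n => BimodTensor.add_tmul _ _ _) (fun m n n' => BimodTensor.tmul_add _ _ _)
    (fun c m n => ?_) (fun c m n => ?_) (fun S hS z => ?_)
  · rw [H.algebraMap_eq]
    exact (congrArg (H.tensorIso M N).hom.hom (BimodTensor.left_smul_tmul _ _ _).symm).trans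
      ((H.tensorIso M N).hom.hom.map_smul _ _)
  · rw [e]
    exact (congrArg (H.tensorIso M N).hom.hom (BimodTensor.right_smul_tmul _ _ _).symm).trans
      ((H.tensorIso M N).hom.hom.map_smul _ _)
  · obtain ⟨z, rfl⟩ : ∃ z', (H.tensorIso M N).hom.hom z' = z := ⟨z, rfl⟩
    induction z using BimodCat.induction_on with
    | tmul m n => exact hS m n
    | add x y hx hy => rw [map_add]; exact S.add_mem hx hy

/-- The category of finite-dimensional modules over a left bialgebroid. -/
def FDMod (_ : LeftBialgebroid k R A) : Type (w + 1) := FDModCat k A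

instance : Category.{w} H.FDMod := inferInstanceAs (Category (FDModCat k A))

instance : Preadditive H.FDMod := inferInstanceAs (Preadditive (FDModCat k A))

instance : Linear k H.FDMod := inferInstanceAs (Linear k (FDModCat k A))

/-- The monoidal structure on finite-dimensional modules over a left bialgebroid, with monoidal
product `M ⊗_R N` and unit `R`. -/
instance [Module.Finite k R] : MonoidalCategory H.FDMod :=
  letI := H.monoidalCategory
  haveI : (isFiniteDimensional k A).IsMonoidal :=
    { prop_unit := H.finite_unit
      prop_tensor := H.finite_tensor }
  inferInstanceAs (MonoidalCategory (isFiniteDimensional k A).FullSubcategory)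

end LeftBialgebroid

end FiniteDimensional

end

/-! Let `Q` be a projective generator of the category and put P = Q ⊗ ᘁQ. Evaluation and
coevaluation make P a comonoid, and R = End(Q), with composition in diagrammatic order, acts on it
through either factor. The fibre functor is Hom(P, -), which duality identifies with X ↦ Hom(Q, X ⊗
Q). It is lax monoidal by convolution, and convolution factors through ⊗_R. In the second
description the convolution of f and g is f followed by X ◁ g, so the tensor constraint is the map
Hom(Q, X ⊗ Q) ⊗_R Hom(Q, Z ⊗ Q) → Hom(Q, X ⊗ (Z ⊗ Q)). Since X has a dual, X ⊗ - is right exact, and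
an Eilenberg–Watts argument (`bijective_of_balanced`) shows that this map is bijective. The unit
constraint is the identification of R with Hom(Q, 𝟙 ⊗ Q).

Hence Hom(P, -) is strong monoidal with values in R-bimodules. It sends the comonoid P to A =
End(P), which becomes a coalgebra; the remaining bialgebroid axioms express that the constraints are
compatible with precomposition by endomorphisms of P (`mul_act`). As P is again a projective
generator, Hom(P, -) is an equivalence onto finite-dimensional A-modules
(`EndOp.isEquivalence_coyonedaFD`), and it is monoidal for the tensor product defined by A.

For the Hopf property, note that the regular A-module is the image of P and therefore has a right
dual. If X has a right dual, then A ⊗ (V ⊗ X) and (A ⊗ V) ⊗ X represent the same functor, so the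
fusion morphism at X is invertible (`isIso_fusion`). The regular module is a generator, and
naturality carries invertibility from it to every A-module (`fusion_bijective`). -/

noncomputable section

/-! ### Endomorphism rings and the functor Hom(P, -) -/

section EndOp

variable {C : Type u} [Category.{w} C]

/-- The endomorphism ring of an object with the product `f * g = f ≫ g`. -/
def EndOp (P : C) : Type w := P ⟶ P

namespace EndOp

variable {P : C}

/-- An endomorphism regarded as an element of the ring. -/
def of (f : P ⟶ P) : EndOp P := f

/-- The endomorphism underlying an element of the ring. -/
def hom (f : EndOp P) : P ⟶ P := f

variable [Preadditive C]

instance : AddCommGroup (EndOp P) := inferInstanceAs (AddCommGroup (P ⟶ P))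

instance : Ring (EndOp P) where
  __ := (inferInstance : AddCommGroup (EndOp P))
  mul f g := of (f.hom ≫ g.hom)
  one := of (𝟙 P)
  mul_assoc f g h := Category.assoc f.hom g.hom h.hom
  one_mul f := Category.id_comp f.hom
  mul_one f := Category.comp_id f.hom
  left_distrib f g h := Preadditive.comp_add _ _ _ f.hom g.hom h.hom
  right_distrib f g h := Preadditive.add_comp _ _ _ f.hom g.hom h.hom
  zero_mul f := Limits.zero_comp (f := f.hom)
  mul_zero f := Limits.comp_zero (f := f.hom)

@[simp] lemma hom_mul (f g : EndOp P) : (f * g).hom = f.hom ≫ g.hom := rfl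
@[simp] lemma hom_add (f g : EndOp P) : (f + g).hom = f.hom + g.hom := rfl

variable {k : Type w} [CommRing k] [Linear k C]

instance : Module k (EndOp P) := inferInstanceAs (Module k (P ⟶ P))

instance : Algebra k (EndOp P) :=
  Algebra.ofModule (fun c f g => Linear.smul_comp _ _ _ c f.hom g.hom)
    (fun c f g => Linear.comp_smul _ _ _ f.hom c g.hom)

/-- Precomposition is a left action because the product of `EndOp P` is composition in diagrammatic
order. -/
instance (X : C) : Module (EndOp P) (P ⟶ X) where
  smul a f := a.hom ≫ f
  one_smul f := Category.id_comp f
  mul_smul a b f := Category.assoc a.hom b.hom f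
  smul_zero _ := Limits.comp_zero
  smul_add a f g := Preadditive.comp_add _ _ _ a.hom f g
  zero_smul _ := Limits.zero_comp
  add_smul a b f := Preadditive.add_comp _ _ _ a.hom b.hom f

variable (P) in
/-- The functor `Hom(P, -)` with values in modules over the endomorphism ring of `P`. -/
def coyoneda : C ⥤ ModuleCat.{w} (EndOp P) where
  obj X := ModuleCat.of (EndOp P) (P ⟶ X)
  map {X Y} f := ModuleCat.ofHom
    { toFun := fun g : P ⟶ X => (g ≫ f : P ⟶ Y)
      map_add' := fun g g' => Preadditive.add_comp _ _ _ g g' f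
      map_smul' := fun a g => Category.assoc a.hom g f }
  map_id X := by ext g; exact Category.comp_id _
  map_comp f g := by ext h; exact (Category.assoc _ _ _).symm

end EndOp

end EndOp

/-! ### Convolution, and the bialgebroid of endomorphisms of a comonoid -/

section Convolution

variable {C : Type u} [Category.{w} C] [MonoidalCategory C]

open ComonObj

/-- The convolution of two morphisms from a comonoid. -/
def conv {P X Y : C} [ComonObj P] (f : P ⟶ X) (g : P ⟶ Y) : P ⟶ X ⊗ Y := Δ[P] ≫ (f ⊗ₘ g)

section

variable {P X Y Z : C} [ComonObj P]

lemma conv_whiskerRight (f : P ⟶ X) (g : P ⟶ Y) (h : X ⟶ Z) :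
    conv f g ≫ h ▷ Y = conv (f ≫ h) g := by
  rw [conv, Category.assoc, ← tensorHom_id, tensorHom_comp_tensorHom, Category.comp_id, conv]

lemma conv_whiskerLeft (f : P ⟶ X) (g : P ⟶ Y) (h : Y ⟶ Z) :
    conv f g ≫ X ◁ h = conv f (g ≫ h) := by
  rw [conv, Category.assoc, ← id_tensorHom, tensorHom_comp_tensorHom, Category.comp_id, conv]

lemma conv_tensorHom {X' Y' : C} (f : P ⟶ X) (g : P ⟶ Y) (h : X ⟶ X') (h' : Y ⟶ Y') :
    conv f g ≫ (h ⊗ₘ h') = conv (f ≫ h) (g ≫ h') := by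
  simp [conv]

lemma whiskerRight_conv (a : P ⟶ P) (f : P ⟶ X) (g : P ⟶ Y) :
    Δ[P] ≫ a ▷ P ≫ (f ⊗ₘ g) = conv (a ≫ f) g := by
  rw [conv, ← tensorHom_id, tensorHom_comp_tensorHom, Category.id_comp]

lemma whiskerLeft_conv (a : P ⟶ P) (f : P ⟶ X) (g : P ⟶ Y) :
    Δ[P] ≫ P ◁ a ≫ (f ⊗ₘ g) = conv f (a ≫ g) := by
  rw [conv, ← id_tensorHom, tensorHom_comp_tensorHom, Category.id_comp]

/-- Coassociativity of `P` seen through Hom(P, -): this is the associativity axiom of a lax monoidal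
functor, and `counit_conv` and `conv_counit` supply the unit axioms. -/
lemma conv_assoc (f : P ⟶ X) (g : P ⟶ Y) (h : P ⟶ Z) :
    conv (conv f g) h ≫ (α_ X Y Z).hom = conv f (conv g h) := by
  have h₁ : conv (conv f g) h = Δ[P] ≫ Δ[P] ▷ P ≫ ((f ⊗ₘ g) ⊗ₘ h) := by
    rw [conv, conv, ← tensorHom_id, tensorHom_comp_tensorHom, Category.id_comp]
  have h₂ : conv f (conv g h) = Δ[P] ≫ P ◁ Δ[P] ≫ (f ⊗ₘ (g ⊗ₘ h)) := by
    rw [conv, conv, ← id_tensorHom, tensorHom_comp_tensorHom, Category.id_comp]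
  rw [h₁, h₂, Category.assoc, Category.assoc, associator_naturality, ComonObj.comul_assoc_assoc]

lemma counit_conv (f : P ⟶ X) : conv ε[P] f ≫ (λ_ X).hom = f := by
  rw [conv, counit_comul_hom, Category.assoc, Iso.inv_hom_id, Category.comp_id]

lemma conv_counit (f : P ⟶ X) : conv f ε[P] ≫ (ρ_ X).hom = f := by
  rw [conv, comul_counit_hom, Category.assoc, Iso.inv_hom_id, Category.comp_id]

variable [Preadditive C] [MonoidalPreadditive C]

lemma add_conv (f f' : P ⟶ X) (g : P ⟶ Y) : conv (f + f') g = conv f g + conv f' g := by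
  rw [conv, MonoidalPreadditive.add_tensor, Preadditive.comp_add]; rfl

lemma conv_add (f : P ⟶ X) (g g' : P ⟶ Y) : conv f (g + g') = conv f g + conv f g' := by
  rw [conv, MonoidalPreadditive.tensor_add, Preadditive.comp_add]; rfl

end

variable [Preadditive C]

/-- Source and target maps into the endomorphism ring of a comonoid `P` that are compatible with the
comultiplication and the counit of `P`. -/
structure ComonoidBase (k : Type w) [CommRing k] [Linear k C] (R : Type w) [Ring R] [Algebra k R]
    (P : C) [ComonObj P] extends SourceTarget k R (EndOp P) where
  comul_balanced : ∀ r, Δ[P] ≫ (t (op r)).hom ▷ P = Δ[P] ≫ P ◁ (s r).hom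
  source_comul : ∀ r, (s r).hom ≫ Δ[P] = Δ[P] ≫ (s r).hom ▷ P
  target_comul : ∀ r, (t (op r)).hom ≫ Δ[P] = Δ[P] ≫ P ◁ (t (op r)).hom
  source_counit : ∀ r, (s r).hom ≫ ε[P] = (t (op r)).hom ≫ ε[P]

namespace ComonoidBase

variable {k : Type w} [CommRing k] [Linear k C] {R : Type w} [Ring R] [Algebra k R] {P : C}
  [ComonObj P] (B : ComonoidBase k R P)

/-- The functor `Hom(P, -)` with values in bimodules. -/
abbrev fiber : C ⥤ BimodCat k R := EndOp.coyoneda P ⋙ B.res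

/-- A morphism `P ⟶ X` regarded as an element of the bimodule `Hom(P, X)`. -/
def elt {X : C} (f : P ⟶ X) : B.fiber.obj X := f

lemma left_smul {X : C} (r : R) (f : P ⟶ X) :
    Envelope.left k r • B.elt f = B.elt ((B.s r).hom ≫ f) := by
  change (B.e (Envelope.left k r)).hom ≫ f = (B.s r).hom ≫ f
  rw [SourceTarget.e_tmul, map_one, mul_one]

lemma right_smul {X : C} (r : R) (f : P ⟶ X) :
    Envelope.right k r • B.elt f = B.elt ((B.t (op r)).hom ≫ f) := by
  change (B.e (Envelope.right k r)).hom ≫ f = (B.t (op r)).hom ≫ f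
  rw [SourceTarget.e_tmul, map_one, one_mul]

lemma tmul_smul {X : C} (r : R) (r' : Rᵐᵒᵖ) (f : P ⟶ X) :
    (r ⊗ₜ[k] r' : Envelope k R) • B.elt f = B.elt ((B.s r).hom ≫ (B.t r').hom ≫ f) :=
  Category.assoc (B.s r).hom (B.t r').hom f

/-- The right action of R on Hom(P, X) is through `t` and the left action on Hom(P, Y) through `s`,
so this is what makes convolution descend to ⊗_R. The lemmas `source_conv` and `target_conv` then
make the induced map a morphism of bimodules. -/
lemma conv_balanced {X Y : C} (r : R) (f : P ⟶ X) (g : P ⟶ Y) :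
    conv ((B.t (op r)).hom ≫ f) g = conv f ((B.s r).hom ≫ g) := by
  rw [← whiskerRight_conv, ← whiskerLeft_conv, reassoc_of% B.comul_balanced r]

lemma source_conv {X Y : C} (r : R) (f : P ⟶ X) (g : P ⟶ Y) :
    (B.s r).hom ≫ conv f g = conv ((B.s r).hom ≫ f) g := by
  rw [← whiskerRight_conv, conv, reassoc_of% B.source_comul r]

lemma target_conv {X Y : C} (r : R) (f : P ⟶ X) (g : P ⟶ Y) :
    (B.t (op r)).hom ≫ conv f g = conv f ((B.t (op r)).hom ≫ g) := by
  rw [← whiskerLeft_conv, conv, reassoc_of% B.target_comul r]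

lemma source_comp {X : C} (r : R) (f : P ⟶ X) :
    (B.s r).hom ≫ f = conv ((B.s r).hom ≫ ε[P]) f ≫ (λ_ X).hom := by
  rw [← B.source_conv, Category.assoc, counit_conv]

/-- The unit constraint is defined with `s`, whereas the right action uses `t`; `source_counit`
reconciles the two after composition with the counit. -/
lemma target_comp {X : C} (r : R) (f : P ⟶ X) :
    (B.t (op r)).hom ≫ f = conv f ((B.s r).hom ≫ ε[P]) ≫ (ρ_ X).hom := by
  rw [B.source_counit, ← B.target_conv, Category.assoc, conv_counit]

variable [MonoidalPreadditive C]

/-- The convolution product `f ⊗ g ↦ Δ ≫ (f ⊗ g)`. -/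
def mul (X Y : C) : B.fiber.obj X ⊗ B.fiber.obj Y ⟶ B.fiber.obj (X ⊗ Y) :=
  ModuleCat.ofHom (Y := B.fiber.obj (X ⊗ Y)) <| Envelope.linearMap
    (N := B.fiber.obj (X ⊗ Y))
    (BimodTensor.lift (M := B.fiber.obj X) (N := B.fiber.obj Y)
      (fun (f : P ⟶ X) (g : P ⟶ Y) => B.elt (conv f g))
      (fun f f' g => add_conv _ _ _) (fun f g g' => conv_add _ _ _)
      (fun r f g => by
        have h₁ := B.right_smul r (show P ⟶ X from f)
        have h₂ := B.left_smul r (show P ⟶ Y from g)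
        change B.elt (conv (show P ⟶ X from Envelope.right k r • B.elt f) g) =
          B.elt (conv f (show P ⟶ Y from Envelope.left k r • B.elt g))
        rw [h₁, h₂]
        exact B.conv_balanced r f g))
    (fun r r' z => by
      induction z using BimodTensor.induction_on with
      | add x y hx hy =>
        rw [smul_add, map_add, map_add]
        exact (congrArg₂ (· + ·) hx hy).trans (smul_add _ _ _).symm
      | tmul f g =>
        have h₁ := B.left_smul r (show P ⟶ X from f)
        have h₂ := B.right_smul (unop r') (show P ⟶ Y from g)
        refine Eq.trans ?_ (B.tmul_smul r r' (conv f g)).symm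
        change B.elt (conv (show P ⟶ X from Envelope.left k r • B.elt f)
          (show P ⟶ Y from Envelope.right k (unop r') • B.elt g)) = _
        rw [h₁, h₂]
        exact (((B.source_conv _ _ _).symm.trans
          (congrArg _ (B.target_conv (unop r') _ _).symm))))

/-- The map `r ↦ s(r) ≫ ε`. -/
def unit : 𝟙_ (BimodCat k R) ⟶ B.fiber.obj (𝟙_ C) :=
  ModuleCat.ofHom (X := UnitBimod k R) (Y := B.fiber.obj (𝟙_ C)) <| Envelope.linearMap
    (M := UnitBimod k R) (N := B.fiber.obj (𝟙_ C))
    (AddMonoidHom.mk' (fun r => B.elt ((B.s r.val).hom ≫ ε[P])) (fun r r' => by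
      rw [UnitBimod.val_add, map_add, EndOp.hom_add, Preadditive.add_comp]; rfl))
    (fun r r' x => by
      refine Eq.trans ?_ (B.tmul_smul r r' _).symm
      rw [UnitBimod.smul_eq]
      change (B.s (r * (x.val * unop r'))).hom ≫ ε[P] =
        (B.s r).hom ≫ (B.t r').hom ≫ (B.s x.val).hom ≫ ε[P]
      -- The right action of r' is by t(r'). Commuting it past s(x) puts it next to the counit,
      -- where it agrees with s(r').
      have h := congrArg EndOp.hom (B.commute x.val r').eq
      rw [EndOp.hom_mul, EndOp.hom_mul] at h
      rw [← reassoc_of% h, map_mul, map_mul, EndOp.hom_mul, EndOp.hom_mul, Category.assoc,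
        Category.assoc, B.source_counit (unop r')]
      rfl)

variable (hunit : Function.Bijective B.unit.hom) (hmul : ∀ X Y, Function.Bijective (B.mul X Y).hom)

/-- The monoidal structure on the functor `Hom(P, -)`. -/
def fiberCore : B.fiber.CoreMonoidal where
  εIso := (LinearEquiv.ofBijective B.unit.hom hunit).toModuleIso
  μIso X Y := (LinearEquiv.ofBijective (B.mul X Y).hom (hmul X Y)).toModuleIso
  μIso_hom_natural_left {_ _} f _ :=
    ModuleCat.hom_ext (BimodTensor.linearMap_ext fun _ _ => (conv_whiskerRight _ _ f).symm)
  μIso_hom_natural_right {_ _} _ f :=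
    ModuleCat.hom_ext (BimodTensor.linearMap_ext fun _ _ => (conv_whiskerLeft _ _ f).symm)
  associativity _ _ _ :=
    ModuleCat.hom_ext (BimodTensor.linearMap_ext_left fun _ _ _ => conv_assoc _ _ _)
  left_unitality _ := ModuleCat.hom_ext (BimodTensor.linearMap_ext fun _ _ =>
    (B.left_smul _ _).trans (B.source_comp _ _))
  right_unitality _ := ModuleCat.hom_ext (BimodTensor.linearMap_ext fun _ _ =>
    (B.right_smul _ _).trans (B.target_comp _ _))

/-- The comonoid structure on `Hom(P, P)`, which is the regular bimodule of `EndOp P`. -/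
def coalgebra : ComonObj B.regular :=
  letI := (B.fiberCore hunit hmul).toMonoidal
  Functor.obj.instComonObj P B.fiber

/-- The inverse of `mul`. -/
def comulAt {X Y : C} (f : P ⟶ X ⊗ Y) : (B.fiber.obj X ⊗ B.fiber.obj Y : BimodCat k R) :=
  ((B.fiberCore hunit hmul).μIso X Y).inv.hom (B.elt f)

lemma mul_comulAt {X Y : C} (f : P ⟶ X ⊗ Y) :
    (B.mul X Y).hom (B.comulAt hunit hmul f) = B.elt f :=
  congrArg (fun h => h.hom (B.elt f)) ((B.fiberCore hunit hmul).μIso X Y).inv_hom_id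

/-- The coalgebra is the image of the comonoid `P` under a strong monoidal functor, so its
comultiplication is postcomposition with Δ followed by the inverse of convolution. -/
lemma comul_eq (a : EndOp P) :
    B.comul (B.coalgebra hunit hmul) a = B.comulAt hunit hmul (a.hom ≫ Δ[P]) := rfl

lemma source_counit_eq (a : EndOp P) :
    (B.s (B.counit (B.coalgebra hunit hmul) a)).hom ≫ ε[P] = a.hom ≫ ε[P] :=
  congrArg (fun h => h.hom (B.elt (a.hom ≫ ε[P]))) (B.fiberCore hunit hmul).εIso.inv_hom_id

/-- Injectivity of `unit` characterises the counit of a by one equation between morphisms P ⟶ 𝟙. The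
counit axioms of the bialgebroid are all verified through it. -/
lemma counit_eq {a : EndOp P} {r : R} (h : (B.s r).hom ≫ ε[P] = a.hom ≫ ε[P]) :
    B.counit (B.coalgebra hunit hmul) a = r :=
  hunit.1 ((B.source_counit_eq hunit hmul a).trans h.symm)

lemma mul_tensorHom {X Y X' Y' : C} (f : X ⟶ X') (g : Y ⟶ Y')
    (z : (B.fiber.obj X ⊗ B.fiber.obj Y : BimodCat k R)) :
    (B.mul X' Y').hom ((B.fiber.map f ⊗ₘ B.fiber.map g).hom z) =
      (B.fiber.map (f ⊗ₘ g)).hom ((B.mul X Y).hom z) := by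
  induction z using BimodCat.induction_on with
  | tmul m n => exact (conv_tensorHom _ _ f g).symm
  | add x y hx hy => rw [map_add, map_add, map_add, map_add, hx, hy]

lemma mul_comul (a : EndOp P) : (B.mul P P).hom (B.comul (B.coalgebra hunit hmul) a) =
    B.elt (a.hom ≫ Δ[P]) :=
  B.mul_comulAt hunit hmul _

lemma comul_mem (a : EndOp P) : B.comul (B.coalgebra hunit hmul) a ∈ B.takeuchi := by
  intro r
  have key : (B.fiber.map (B.t (op r)).hom ⊗ₘ B.fiber.map (𝟙 P)).hom
      (B.comulAt hunit hmul (a.hom ≫ Δ[P])) =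
      (B.fiber.map (𝟙 P) ⊗ₘ B.fiber.map (B.s r).hom).hom
        (B.comulAt hunit hmul (a.hom ≫ Δ[P])) := by
    -- Convolution is natural in both factors, so after applying the injective map `mul` the
    -- Takeuchi condition becomes `comul_balanced`.
    apply (hmul P P).1
    rw [B.mul_tensorHom, B.mul_tensorHom, B.mul_comulAt]
    change (a.hom ≫ Δ[P]) ≫ ((B.t (op r)).hom ⊗ₘ 𝟙 P) = (a.hom ≫ Δ[P]) ≫ (𝟙 P ⊗ₘ (B.s r).hom)
    rw [tensorHom_id, id_tensorHom, Category.assoc, Category.assoc, B.comul_balanced]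
  rw [B.fiber.map_id, tensorHom_id, id_tensorHom] at key
  exact key

/-- Through convolution, letting Δ(a) act on a tensor is the same as precomposing with a.
Multiplicativity of Δ and A-linearity of the tensor constraint both reduce in this way to
associativity of composition. -/
lemma mul_act (a : EndOp P) (ha) {X Y : C} (z : (B.fiber.obj X ⊗ B.fiber.obj Y : BimodCat k R)) :
    (B.mul X Y).hom (B.act (M := (EndOp.coyoneda P).obj X) (N := (EndOp.coyoneda P).obj Y)
      ⟨B.comul (B.coalgebra hunit hmul) a, ha⟩ z) =
      (show P ⟶ X ⊗ Y from a.hom ≫ (show P ⟶ X ⊗ Y from (B.mul X Y).hom z)) := by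
  induction z using BimodCat.induction_on with
  | add x y hx hy =>
    rw [map_add, map_add, map_add, hx, hy]
    exact (Preadditive.comp_add _ _ _ _ _ _).symm
  | tmul m n =>
    rw [SourceTarget.act_tmul]
    refine (B.mul_tensorHom m n _).trans ((congrArg _ (B.mul_comul hunit hmul a)).trans ?_)
    exact Category.assoc a.hom Δ[P] _

/-- The left bialgebroid of endomorphisms of `P`. -/
def bialgebroid : LeftBialgebroid k R (EndOp P) where
  toSourceTarget := B.toSourceTarget
  coalgebra := B.coalgebra hunit hmul
  comul_mem := B.comul_mem hunit hmul
  comul_one := by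
    apply (hmul P P).1
    rw [B.comul_eq, B.mul_comulAt]
    change 𝟙 P ≫ Δ[P] = Δ[P] ≫ (𝟙 P ⊗ₘ 𝟙 P)
    rw [Category.id_comp, id_tensorHom_id, Category.comp_id]
  comul_mul a b := by
    apply (hmul P P).1
    refine Eq.trans ?_ (B.mul_act hunit hmul a _ _).symm
    rw [B.comul_eq, B.comul_eq, B.mul_comulAt, B.mul_comulAt]
    exact Category.assoc a.hom b.hom _
  counit_mul_source a b := by
    apply B.counit_eq
    rw [B.source_counit_eq, EndOp.hom_mul, EndOp.hom_mul, Category.assoc, Category.assoc,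
      B.source_counit_eq]
  counit_mul_target a b := by
    apply B.counit_eq
    rw [B.source_counit_eq, EndOp.hom_mul, EndOp.hom_mul, Category.assoc, Category.assoc,
      ← B.source_counit, B.source_counit_eq]
  counit_one := B.counit_eq hunit hmul (by rw [map_one])

end ComonoidBase

end Convolution

/-! ### Hom(P, -) as a monoidal functor to modules over the bialgebroid -/

section Comparison

variable {C : Type u} [Category.{w} C] [Preadditive C] {k : Type w} [CommRing k] [Linear k C]
  [MonoidalCategory C] [MonoidalPreadditive C] {R : Type w} [Ring R] [Algebra k R] {P : C}
  [ComonObj P] (B : ComonoidBase k R P) (hunit : Function.Bijective B.unit.hom)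
  (hmul : ∀ X Y, Function.Bijective (B.mul X Y).hom)

open ComonObj

namespace ComonoidBase

/-- The unit constraint of `Hom(P, -)` as an isomorphism of modules. -/
def unitIso : ModuleCat.of (EndOp P) (B.bialgebroid hunit hmul).UnitModule ≅
    (EndOp.coyoneda P).obj (𝟙_ C) :=
  (B.bialgebroid hunit hmul).liftIso
    ((B.bialgebroid hunit hmul).unitIso.symm ≪≫ (B.fiberCore hunit hmul).εIso) (fun r => by
      ext a
      refine (B.source_counit_eq hunit hmul _).trans ?_
      exact Category.assoc (EndOp.hom (show EndOp P from a)) _ _)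

/-- The tensor constraint of `Hom(P, -)` as an isomorphism of modules. -/
def tensorIso (X Y : C) : ModuleCat.of (EndOp P) ((B.bialgebroid hunit hmul).Tensor
      ((EndOp.coyoneda P).obj X) ((EndOp.coyoneda P).obj Y)) ≅ (EndOp.coyoneda P).obj (X ⊗ Y) :=
  (B.bialgebroid hunit hmul).liftIso
    (((B.bialgebroid hunit hmul).tensorIso _ _).symm ≪≫ (B.fiberCore hunit hmul).μIso X Y)
    (fun z => by
      ext a
      exact B.mul_act hunit hmul (show EndOp P from a) _ _)

/-- The tensor product of A-modules has the tensor product of bimodules as underlying group, with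
the same associator. On pure tensors the claim is therefore `conv_assoc`, and additivity does the
rest. -/
lemma coyoneda_associativity (X Y Z : C) :
    letI := (B.bialgebroid hunit hmul).monoidalCategory
    (B.tensorIso hunit hmul X Y).hom ▷ (EndOp.coyoneda P).obj Z ≫
      (B.tensorIso hunit hmul (X ⊗ Y) Z).hom ≫ (EndOp.coyoneda P).map (α_ X Y Z).hom =
    (α_ ((EndOp.coyoneda P).obj X) ((EndOp.coyoneda P).obj Y) ((EndOp.coyoneda P).obj Z)).hom ≫
      (EndOp.coyoneda P).obj X ◁ (B.tensorIso hunit hmul Y Z).hom ≫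
        (B.tensorIso hunit hmul X (Y ⊗ Z)).hom := by
  apply ModuleCat.hom_ext
  apply LinearMap.toAddMonoidHom_injective
  let T : BimodCat k R := B.res.obj (ModuleCat.of (EndOp P) ((B.bialgebroid hunit hmul).Tensor
    ((EndOp.coyoneda P).obj X) ((EndOp.coyoneda P).obj Y)))
  refine BimodTensor.hom_ext (M := T) (N := B.fiber.obj Z) fun z h => ?_
  induction z using BimodTensor.induction_on (M := B.fiber.obj X) (N := B.fiber.obj Y) with
  | tmul f g =>
    have key := conv_assoc (show P ⟶ X from f) (show P ⟶ Y from g) (show P ⟶ Z from h)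
    exact key
  | add x y hx hy =>
    have key := congrArg₂ (· + ·) hx hy
    have e (x y : T) : BimodTensor.tmul k R (M := T) (N := B.fiber.obj Z) (x + y) h =
      BimodTensor.tmul k R (M := T) (N := B.fiber.obj Z) x h +
      BimodTensor.tmul k R (M := T) (N := B.fiber.obj Z) y h := BimodTensor.add_tmul _ _ _
    refine (congrArg _ (e x y)).trans ((map_add _ _ _).trans (key.trans ?_))
    exact ((congrArg _ (e x y)).trans (map_add _ _ _)).symm

lemma coyoneda_left_unitality (X : C) :
    letI := (B.bialgebroid hunit hmul).monoidalCategory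
    (λ_ ((EndOp.coyoneda P).obj X)).hom =
      (B.unitIso hunit hmul).hom ▷ (EndOp.coyoneda P).obj X ≫
        (B.tensorIso hunit hmul (𝟙_ C) X).hom ≫ (EndOp.coyoneda P).map (λ_ X).hom := by
  apply ModuleCat.hom_ext
  apply LinearMap.toAddMonoidHom_injective
  refine BimodTensor.hom_ext
    (M := B.res.obj (ModuleCat.of (EndOp P) (B.bialgebroid hunit hmul).UnitModule))
    (N := B.fiber.obj X) fun r g => ?_
  have h₁ := B.left_smul (show R from r) (show P ⟶ X from g)
  have h₂ := B.source_comp (show R from r) (show P ⟶ X from g)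
  refine Eq.trans h₁ ?_
  exact h₂

lemma coyoneda_right_unitality (X : C) :
    letI := (B.bialgebroid hunit hmul).monoidalCategory
    (ρ_ ((EndOp.coyoneda P).obj X)).hom =
      (EndOp.coyoneda P).obj X ◁ (B.unitIso hunit hmul).hom ≫
        (B.tensorIso hunit hmul X (𝟙_ C)).hom ≫ (EndOp.coyoneda P).map (ρ_ X).hom := by
  apply ModuleCat.hom_ext
  apply LinearMap.toAddMonoidHom_injective
  refine BimodTensor.hom_ext (M := B.fiber.obj X)
    (N := B.res.obj (ModuleCat.of (EndOp P) (B.bialgebroid hunit hmul).UnitModule))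
    fun g r => ?_
  have h₁ := B.right_smul (show R from r) (show P ⟶ X from g)
  have h₂ := B.target_comp (show R from r) (show P ⟶ X from g)
  refine Eq.trans h₁ ?_
  exact h₂

/-- The monoidal structure on the functor `Hom(P, -)` with values in modules over the bialgebroid of
endomorphisms of `P`. -/
def coyonedaCore : letI := (B.bialgebroid hunit hmul).monoidalCategory
    (EndOp.coyoneda P).CoreMonoidal :=
  letI := (B.bialgebroid hunit hmul).monoidalCategory
  { εIso := B.unitIso hunit hmul
    μIso := B.tensorIso hunit hmul
    μIso_hom_natural_left := fun f X' => ModuleCat.hom_ext (LinearMap.ext fun z =>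
      congrArg (fun f => f.hom z) ((B.fiberCore hunit hmul).μIso_hom_natural_left f X'))
    μIso_hom_natural_right := fun X' f => ModuleCat.hom_ext (LinearMap.ext fun z =>
      congrArg (fun f => f.hom z) ((B.fiberCore hunit hmul).μIso_hom_natural_right X' f))
    associativity := B.coyoneda_associativity hunit hmul
    left_unitality := B.coyoneda_left_unitality hunit hmul
    right_unitality := B.coyoneda_right_unitality hunit hmul }

end ComonoidBase

end Comparison

/-! ### Monoidal functors into full monoidal subcategories -/

section Lift

variable {C : Type*} [Category* C] [MonoidalCategory C] {D : Type*} [Category* D]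
  [MonoidalCategory D] (Q : ObjectProperty D) [Q.IsMonoidal] (F : C ⥤ D)

/-- A monoidal functor with values in a full monoidal subcategory is monoidal. -/
def liftCoreMonoidal (F : C ⥤ D) (hF : ∀ X, Q (F.obj X)) (c : F.CoreMonoidal) :
    (Q.lift F hF).CoreMonoidal where
  εIso := Q.isoMk c.εIso
  μIso X Y := Q.isoMk (c.μIso X Y)
  μIso_hom_natural_left f X' := by ext; exact c.μIso_hom_natural_left f X'
  μIso_hom_natural_right X' f := by ext; exact c.μIso_hom_natural_right X' f
  associativity X Y Z := by ext; exact c.associativity X Y Z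
  left_unitality X := by ext; exact c.left_unitality X
  right_unitality X := by ext; exact c.right_unitality X

end Lift

/-! ### Restriction to finite-dimensional modules -/

section FiniteDimensional

open scoped ModuleCat

variable {C : Type u} [Category.{w} C] [Preadditive C] {k : Type w} [Field k] [Linear k C]

variable (k) in
lemma EndOp.finite_coyoneda (P : C) [∀ X : C, Module.Finite k (P ⟶ X)] (X : C) :
    isFiniteDimensional k (EndOp P) ((EndOp.coyoneda P).obj X) :=
  Module.Finite.of_surjective
    ({ toFun := fun f => f
       map_add' := fun _ _ => rfl
       map_smul' := fun c f => by
        -- On an A-module k acts through the structure map k → A, which sends c to c • 𝟙.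
        change c • f = (c • 𝟙 P) ≫ f
        rw [Linear.smul_comp, Category.id_comp] } :
      (P ⟶ X) →ₗ[k] (EndOp.coyoneda P).obj X) Function.surjective_id

variable (k) in
/-- The functor `Hom(P, -)` with values in finite-dimensional modules. -/
def EndOp.coyonedaFD (P : C) [∀ X : C, Module.Finite k (P ⟶ X)] :
    C ⥤ FDModCat k (EndOp P) :=
  (isFiniteDimensional k (EndOp P)).lift (EndOp.coyoneda P) (EndOp.finite_coyoneda k P)

instance (P : C) [∀ X : C, Module.Finite k (P ⟶ X)] : (EndOp.coyonedaFD k P).Additive where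
  map_add {X Y f g} := by
    ext h
    exact Preadditive.comp_add _ _ _ _ _ _

instance (P : C) [∀ X : C, Module.Finite k (P ⟶ X)] : (EndOp.coyonedaFD k P).Linear k where
  map_smul {X Y} f c := by
    ext h
    change (show P ⟶ X from h) ≫ (c • f) = (c • 𝟙 P) ≫ (show P ⟶ X from h) ≫ f
    rw [Linear.comp_smul, Linear.smul_comp, Category.id_comp]

variable [MonoidalCategory C] [MonoidalPreadditive C] {R : Type w} [Ring R] [Algebra k R]
  [Module.Finite k R] {P : C} [∀ X : C, Module.Finite k (P ⟶ X)]
  [ComonObj P] (B : ComonoidBase k R P) (hunit : Function.Bijective B.unit.hom)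
  (hmul : ∀ X Y, Function.Bijective (B.mul X Y).hom)

/-- The functor `Hom(P, -)` with values in finite-dimensional modules over the bialgebroid. -/
def ComonoidBase.toFDMod : C ⥤ (B.bialgebroid hunit hmul).FDMod := EndOp.coyonedaFD k P

/-- The monoidal structure of `toFDMod`. -/
def ComonoidBase.toFDModMonoidal : (B.toFDMod hunit hmul).Monoidal :=
  letI := (B.bialgebroid hunit hmul).monoidalCategory
  haveI : (isFiniteDimensional k (EndOp P)).IsMonoidal :=
    { prop_unit := (B.bialgebroid hunit hmul).finite_unit
      prop_tensor := (B.bialgebroid hunit hmul).finite_tensor }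
  (liftCoreMonoidal (isFiniteDimensional k (EndOp P)) (EndOp.coyoneda P)
    (EndOp.finite_coyoneda k P) (B.coyonedaCore hunit hmul)).toMonoidal

end FiniteDimensional

/-! ### Duals and invertibility of fusion morphisms -/

section Fusion

open Functor.LaxMonoidal Functor.OplaxMonoidal

variable {𝒜 ℬ : Type*} [Category* 𝒜] [Category* ℬ] [MonoidalCategory 𝒜] [MonoidalCategory ℬ]
  (U : 𝒜 ⥤ ℬ) [U.Monoidal]

/-- The image of an exact pairing under a monoidal functor. -/
@[reducible]
def exactPairingMap (X Y : 𝒜) [ExactPairing X Y] : ExactPairing (U.obj X) (U.obj Y) where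
  coevaluation' := ε U ≫ U.map (η_ X Y) ≫ δ U X Y
  evaluation' := μ U Y X ≫ U.map (ε_ X Y) ≫ η U
  coevaluation_evaluation' := by
    -- The triangle identity upstairs is mapped by `U` and conjugated by its structure isomorphisms;
    -- simplification then cancels these in pairs.
    have h := congrArg (fun f => U.obj Y ◁ ε U ≫ μ U _ _ ≫ U.map f ≫ δ U _ _ ≫ η U ▷ U.obj Y)
      (ExactPairing.coevaluation_evaluation X Y)
    simpa only [whiskerLeft_comp, comp_whiskerRight, Category.assoc,
      Functor.map_comp, Functor.Monoidal.μ_δ_assoc, Functor.Monoidal.whiskerRight_μ_δ,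
      Functor.Monoidal.whiskerRight_μ_δ_assoc, Functor.Monoidal.whiskerRight_ε_η,
      Functor.Monoidal.whiskerLeft_ε_η, Functor.Monoidal.whiskerLeft_ε_η_assoc,
      Functor.Monoidal.whiskerRight_ε_η_assoc, Category.comp_id, Functor.Monoidal.μ_δ,
      Functor.Monoidal.whiskerLeft_μ_δ, Functor.Monoidal.whiskerLeft_μ_δ_assoc,
      Functor.Monoidal.map_whiskerLeft,
      Functor.Monoidal.map_whiskerRight, Functor.Monoidal.map_associator_inv,
      Functor.Monoidal.map_rightUnitor, Functor.Monoidal.map_leftUnitor_inv] using h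
  evaluation_coevaluation' := by
    have h := congrArg (fun f => ε U ▷ U.obj X ≫ μ U _ _ ≫ U.map f ≫ δ U _ _ ≫ U.obj X ◁ η U)
      (ExactPairing.evaluation_coevaluation X Y)
    simpa only [whiskerLeft_comp, comp_whiskerRight, Category.assoc,
      Functor.map_comp, Functor.Monoidal.μ_δ_assoc, Functor.Monoidal.whiskerRight_μ_δ,
      Functor.Monoidal.whiskerRight_μ_δ_assoc, Functor.Monoidal.whiskerRight_ε_η,
      Functor.Monoidal.whiskerLeft_ε_η, Functor.Monoidal.whiskerLeft_ε_η_assoc,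
      Functor.Monoidal.whiskerRight_ε_η_assoc, Category.comp_id, Functor.Monoidal.μ_δ,
      Functor.Monoidal.whiskerLeft_μ_δ, Functor.Monoidal.whiskerLeft_μ_δ_assoc,
      Functor.Monoidal.map_whiskerLeft,
      Functor.Monoidal.map_whiskerRight, Functor.Monoidal.map_associator,
      Functor.Monoidal.map_leftUnitor, Functor.Monoidal.map_rightUnitor_inv] using h

variable {U} in
/-- If `L` and `L'` are free on `V` and on `V ⊗ U(X)`, and if `X` has a right dual, then the canonical
morphism from `L'` to `L ⊗ X` is invertible. -/
lemma isIso_fusion {X : 𝒜} (Y : 𝒜) [ExactPairing X Y] {V : ℬ} {L L' : 𝒜} (i : V ⟶ U.obj L)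
    (j : V ⊗ U.obj X ⟶ U.obj L')
    (hi : ∀ Z, Function.Bijective fun g : L ⟶ Z => i ≫ U.map g)
    (hj : ∀ Z, Function.Bijective fun g : L' ⟶ Z => j ≫ U.map g) (φ : L' ⟶ L ⊗ X)
    (hφ : j ≫ U.map φ = i ▷ U.obj X ≫ μ U L X) : IsIso φ := by
  refine isIso_of_coyoneda_map_bijective φ fun Z => ?_
  rw [← Function.Bijective.of_comp_iff' (hj Z)]
  letI := exactPairingMap U X Y
  -- By Yoneda it suffices to factor precomposition with φ, followed by Hom(L', Z) ≅ Hom(V ⊗ UX,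
  -- UZ), into bijections. The factors are Hom(L ⊗ X, Z) ≅ Hom(L, Z ⊗ Y) ≅ Hom(V, U(Z ⊗ Y)) ≅ Hom(V,
  -- UZ ⊗ UY) ≅ Hom(V ⊗ UX, UZ): duality for X, freeness of L, monoidality of `U`, and duality for
  -- UX.
  have key : (fun g : L' ⟶ Z => j ≫ U.map g) ∘ (fun g : L ⊗ X ⟶ Z => φ ≫ g) =
      (tensorRightHomEquiv V (U.obj X) (U.obj Y) (U.obj Z)).symm ∘
      ((Functor.Monoidal.μIso U Z Y).homToEquiv.symm ∘
        ((fun g : L ⟶ Z ⊗ Y => i ≫ U.map g) ∘ tensorRightHomEquiv L X Y Z)) := by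
    ext g
    obtain ⟨h, rfl⟩ := (tensorRightHomEquiv L X Y Z).symm.surjective g
    simp only [Function.comp_apply, Equiv.apply_symm_apply]
    rw [U.map_comp, reassoc_of% hφ]
    change i ▷ U.obj X ≫ μ U L X ≫ U.map (h ▷ X ≫ (α_ _ _ _).hom ≫ _ ◁ ε_ X Y ≫ (ρ_ _).hom) =
      ((i ≫ U.map h) ≫ δ U Z Y) ▷ U.obj X ≫ (α_ _ _ _).hom ≫
        _ ◁ (μ U Y X ≫ U.map (ε_ X Y) ≫ η U) ≫ (ρ_ _).hom
    simp only [whiskerLeft_comp, comp_whiskerRight, Category.assoc, Functor.map_comp,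
      Functor.Monoidal.μ_δ_assoc,
      Functor.Monoidal.map_whiskerLeft,
      Functor.Monoidal.map_whiskerRight, Functor.Monoidal.map_associator,
      Functor.Monoidal.map_rightUnitor]
  change Function.Bijective ((fun g : L' ⟶ Z => j ≫ U.map g) ∘ (fun g : L ⊗ X ⟶ Z => φ ≫ g))
  rw [key]
  exact (Equiv.bijective _).comp ((Equiv.bijective _).comp ((hi _).comp (Equiv.bijective _)))

end Fusion

/-! ### The left Hopf property: reduction to the regular module -/

section Hopf

variable {k : Type w} [CommRing k] {R : Type w} [Ring R] [Algebra k R]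
  {A : Type w} [Ring A] [Algebra k A] (H : LeftBialgebroid k R A)

namespace LeftBialgebroid

variable {V W : BimodCat k R} {Z Z' : ModuleCat.{w} A}

/-- The additive map `a ⊗ v ↦ a f(v)`. -/
def indLiftAux (f : V ⟶ H.res.obj Z) : H.Induced V →+ Z :=
  BalancedTensor.lift (fun (a : A) (v : V) => a • (show Z from f.hom v))
    (fun a a' v => add_smul a a' (show Z from f.hom v))
    (fun a v v' => by
      rw [map_add]
      exact smul_add a (show Z from f.hom v) (show Z from f.hom v'))
    (fun x a v => by
      have h := f.hom.map_smul x v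
      change (a * H.e x) • (show Z from f.hom v) = a • (show Z from f.hom (x • v))
      rw [h, mul_smul]
      rfl)

/-- The `A`-linear map `A ⊗_{Rᵉ} V ⟶ Z` induced by a morphism of bimodules. -/
def indLift (f : V ⟶ H.res.obj Z) : H.induced V ⟶ Z :=
  ModuleCat.ofHom
    { H.indLiftAux f with
      map_smul' := fun a z => by
        change H.indLiftAux f (a • z) = a • H.indLiftAux f z
        induction z using induced_induction with
        | tmul b v => exact mul_smul a b (show Z from f.hom v)
        | add x y hx hy => rw [smul_add, map_add, map_add, hx, hy, smul_add] }

lemma indLift_tmul (f : V ⟶ H.res.obj Z) (a : A) (v : V) :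
    (H.indLift f).hom (H.indTmul a v) = a • (show Z from f.hom v) := rfl

lemma monadUnit_indLift (f : V ⟶ H.res.obj Z) :
    H.monadUnit V ≫ H.res.map (H.indLift f) = f := by
  ext v
  exact one_smul A (show Z from f.hom v)

variable {H} in
lemma induced_hom_ext {f g : H.induced V ⟶ Z}
    (h : H.monadUnit V ≫ H.res.map f = H.monadUnit V ≫ H.res.map g) : f = g := by
  refine ModuleCat.hom_ext (LinearMap.ext fun z => ?_)
  induction z using induced_induction with
  | tmul a v =>
    have hv : f.hom (H.indTmul 1 v) = g.hom (H.indTmul 1 v) := congrArg (fun f => f.hom v) h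
    have e : H.indTmul a v = a • H.indTmul 1 v := by
      change _ = H.indAct a (H.indTmul 1 v)
      rw [indAct_tmul, mul_one]
    rw [e, map_smul, map_smul, hv]
  | add x y hx hy => rw [map_add, map_add, hx, hy]

/-- Induction along Rᵉ → A is left adjoint to restriction. This provides the freeness hypotheses of
`isIso_fusion`. -/
lemma induced_universal (V : BimodCat k R) (Z : ModuleCat.{w} A) :
    Function.Bijective fun g : H.induced V ⟶ Z => H.monadUnit V ≫ H.res.map g :=
  ⟨fun _ _ h => induced_hom_ext h, fun f => ⟨H.indLift f, H.monadUnit_indLift f⟩⟩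

variable (V Z) in
/-- The fusion morphism `A ⊗_{Rᵉ} (V ⊗_R Z) ⟶ (A ⊗_{Rᵉ} V) ⊗_R Z` for an `A`-module `Z`. -/
def fusion : H.induced (V ⊗ H.res.obj Z) ⟶ ModuleCat.of A (H.Tensor (H.induced V) Z) :=
  H.indLift (H.monadUnit V ▷ H.res.obj Z ≫ (H.tensorIso (H.induced V) Z).hom)

lemma leftFusion_eq (V W : BimodCat k R) :
    H.leftFusion V W = (H.fusion V (H.induced W)).hom.toAddMonoidHom := rfl

/-- The functoriality of `Z ↦ A ⊗_{Rᵉ} (V ⊗_R Z)`. -/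
def indMap (V : BimodCat k R) (f : Z ⟶ Z') :
    H.induced (V ⊗ H.res.obj Z) ⟶ H.induced (V ⊗ H.res.obj Z') :=
  H.indLift (V ◁ H.res.map f ≫ H.monadUnit _)

lemma indMap_comp (V : BimodCat k R) {Z'' : ModuleCat.{w} A} (f : Z ⟶ Z') (g : Z' ⟶ Z'') :
    H.indMap V (f ≫ g) = H.indMap V f ≫ H.indMap V g := by
  refine induced_hom_ext ?_
  rw [H.res.map_comp, indMap, indMap, indMap, monadUnit_indLift, reassoc_of% H.monadUnit_indLift,
    Category.assoc, monadUnit_indLift, H.res.map_comp, whiskerLeft_comp, Category.assoc]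

lemma tensorHom_add_bimod {P Q P' Q' : BimodCat k R} (f : P ⟶ P') (g g' : Q ⟶ Q') :
    f ⊗ₘ (g + g') = (f ⊗ₘ g) + (f ⊗ₘ g') :=
  ModuleCat.hom_ext (LinearMap.ext fun u => SourceTarget.tensorHom_add_right f g g' u)

lemma indMap_add (V : BimodCat k R) (f g : Z ⟶ Z') :
    H.indMap V (f + g) = H.indMap V f + H.indMap V g := by
  refine induced_hom_ext ?_
  have h₁ : H.res.map (f + g) = H.res.map f + H.res.map g := rfl
  have h₂ (f g : H.induced (V ⊗ H.res.obj Z) ⟶ H.induced (V ⊗ H.res.obj Z')) :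
    H.res.map (f + g) = H.res.map f + H.res.map g := rfl
  rw [h₂, Preadditive.comp_add, indMap, indMap, indMap, monadUnit_indLift,
    monadUnit_indLift, monadUnit_indLift, h₁, ← id_tensorHom, tensorHom_add_bimod,
    Preadditive.add_comp, id_tensorHom, id_tensorHom]

lemma fusion_naturality (V : BimodCat k R) (f : Z ⟶ Z') :
    H.indMap V f ≫ H.fusion V Z' = H.fusion V Z ≫ H.tensorMap (𝟙 _) f := by
  refine induced_hom_ext ?_
  have h : H.res.map (H.tensorMap (𝟙 (H.induced V)) f) =
      (H.tensorIso _ _).inv ≫ (_ ◁ H.res.map f) ≫ (H.tensorIso _ _).hom := by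
    rw [← id_tensorHom, ← H.res.map_id]; rfl
  rw [H.res.map_comp, H.res.map_comp, indMap, fusion, fusion, reassoc_of% H.monadUnit_indLift,
    Category.assoc, monadUnit_indLift, h, reassoc_of% H.monadUnit_indLift, Category.assoc, Iso.hom_inv_id_assoc,
    whisker_exchange_assoc]

/-- The `A`-linear map `a ↦ a z`. -/
def orbitHom (z : Z) : ModuleCat.of A A ⟶ Z := ModuleCat.ofHom (LinearMap.toSpanSingleton A Z z)

lemma orbitHom_add (z z' : Z) : orbitHom (z + z') = orbitHom z + orbitHom z' := by
  ext
  exact smul_add (1 : A) z z'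

lemma orbitHom_smul (a : A) (z : Z) :
    orbitHom (a • z) = orbitHom (Z := ModuleCat.of A A) a ≫ orbitHom z := by
  ext
  exact (mul_smul (1 : A) a z).symm

variable {H} in
-- The tensor t ⊗ z is the image of t ⊗ 1 under the map A → Z sending 1 to z, and fusion is natural
-- in that map.
lemma fusion_surjective
    (h : Function.Surjective (H.fusion V (ModuleCat.of A A)).hom) (Z : ModuleCat.{w} A) :
    Function.Surjective (H.fusion V Z).hom := by
  intro y
  induction y using BimodTensor.induction_on (M := H.res.obj (H.induced V)) (N := H.res.obj Z) with
  | tmul t z =>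
    obtain ⟨w, hw⟩ := h (BimodTensor.tmul k R (M := H.res.obj (H.induced V))
      (N := H.regular) t (H.toRegular 1))
    refine ⟨(H.indMap V (orbitHom z)).hom w, ?_⟩
    have e := congrArg (fun f => f.hom w) (H.fusion_naturality V (orbitHom (show Z from z)))
    refine e.trans ((congrArg (H.tensorMap (𝟙 _) (orbitHom (show Z from z))).hom hw).trans ?_)
    have e₁ : (show Z from (1 : A) • (show Z from z)) = z := one_smul A _
    exact congrArg (BimodTensor.tmul k R (M := H.res.obj (H.induced V)) (N := H.res.obj Z) t) e₁
  | add x y hx hy =>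
    obtain ⟨a, rfl⟩ := hx
    obtain ⟨b, rfl⟩ := hy
    exact ⟨a + b, map_add _ a b⟩

lemma fusion_naturality_apply (V : BimodCat k R) (f : Z ⟶ Z') (w : H.Induced (V ⊗ H.res.obj Z)) :
    (H.fusion V Z').hom ((H.indMap V f).hom w) =
      (H.tensorMap (𝟙 (H.induced V)) f).hom ((H.fusion V Z).hom w) :=
  congrArg (fun f => f.hom w) (H.fusion_naturality V f)

section Inverse

variable (e : H.Induced (V ⊗ H.regular) ≃+ H.Tensor (H.induced V) (ModuleCat.of A A))

/-- The element `t ⊗ a` of `(A ⊗_{Rᵉ} V) ⊗_R Z`. -/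
def tensorMk (t : H.Induced V) (z : Z) : H.Tensor (H.induced V) Z :=
  BimodTensor.tmul k R (M := H.res.obj (H.induced V)) (N := H.res.obj Z) t z

lemma add_tensorMk (t t' : H.Induced V) (z : Z) :
    H.tensorMk (t + t') z = H.tensorMk t z + H.tensorMk t' z := BimodTensor.add_tmul _ _ _

lemma tensorMap_orbitHom (t : H.Induced V) (a : A) (z : Z) :
    (H.tensorMap (𝟙 (H.induced V)) (orbitHom z)).hom
      (H.tensorMk (Z := ModuleCat.of A A) t a) = H.tensorMk t (a • z) := rfl

/-- Right multiplication by a is an endomorphism of the regular module, so naturality of fusion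
makes its inverse commute with it. The identity is needed for `fusionInv` to be R-balanced and
natural. -/
lemma indMap_orbitHom_smul (he : ∀ w, e w = (H.fusion V (ModuleCat.of A A)).hom w)
    (t : H.Induced V) (a : A) (z : Z) :
    (H.indMap V (orbitHom (a • z))).hom (e.symm (H.tensorMk (Z := ModuleCat.of A A) t (1 : A))) =
      (H.indMap V (orbitHom z)).hom (e.symm (H.tensorMk (Z := ModuleCat.of A A) t a)) := by
  rw [orbitHom_smul, indMap_comp]
  have key : (H.indMap V (orbitHom (Z := ModuleCat.of A A) a)).hom
      (e.symm (H.tensorMk (Z := ModuleCat.of A A) t (1 : A))) =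
      e.symm (H.tensorMk (Z := ModuleCat.of A A) t a) := by
    refine e.injective ?_
    rw [he, fusion_naturality_apply, ← he, e.apply_symm_apply, e.apply_symm_apply,
      tensorMap_orbitHom]
    exact congrArg (H.tensorMk (Z := ModuleCat.of A A) t) (one_mul a)
  exact congrArg (H.indMap V (orbitHom z)).hom key

/-- The inverse of the fusion morphism for `Z`, given an inverse `e` for the regular module:
`t ⊗ z ↦ e⁻¹(t ⊗ 1) z`. -/
def fusionInv (he : ∀ w, e w = (H.fusion V (ModuleCat.of A A)).hom w)
    : H.Tensor (H.induced V) Z →+ H.Induced (V ⊗ H.res.obj Z) :=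
  BimodTensor.lift (M := H.res.obj (H.induced V)) (N := H.res.obj Z)
    (fun (t : H.Induced V) (z : Z) => (H.indMap V (orbitHom z)).hom
      (e.symm (H.tensorMk (Z := ModuleCat.of A A) t (1 : A))))
    (fun t t' z => by
      refine (congrArg (fun x => (H.indMap V (orbitHom z)).hom (e.symm x))
        (H.add_tensorMk (Z := ModuleCat.of A A) t t' (1 : A))).trans ?_
      rw [map_add]
      exact map_add _ _ _)
    (fun t z z' => by
      refine (congrArg (fun f => (H.indMap V f).hom _)
        (orbitHom_add (show Z from z) (show Z from z'))).trans ?_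
      rw [indMap_add]
      rfl)
    (fun r t z => by
      -- Balancing over R moves r from t onto the 1 in A; `indMap_orbitHom_smul` then moves it from
      -- 1 onto z.
      have h₁ : H.tensorMk (Z := ModuleCat.of A A) (H.e (Envelope.right k r) • (show H.Induced V from t))
          (1 : A) = H.tensorMk (Z := ModuleCat.of A A) t (H.e (Envelope.left k r) * 1) :=
        BimodTensor.smul_tmul (M := H.res.obj (H.induced V)) (N := H.regular) r t (H.toRegular 1)
      have h₂ := H.indMap_orbitHom_smul e he t (H.e (Envelope.left k r)) (show Z from z)
      rw [mul_one] at h₁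
      exact (congrArg (fun x => (H.indMap V (orbitHom z)).hom (e.symm x)) h₁).trans h₂.symm)

lemma fusionInv_tensorMap (he : ∀ w, e w = (H.fusion V (ModuleCat.of A A)).hom w)
    (z : Z) (g : H.Tensor (H.induced V) (ModuleCat.of A A)) :
    H.fusionInv e he ((H.tensorMap (𝟙 (H.induced V)) (orbitHom z)).hom g) =
      (H.indMap V (orbitHom z)).hom (e.symm g) := by
  induction g using BimodTensor.induction_on (M := H.res.obj (H.induced V))
    (N := H.regular) with
  | tmul t a =>
    refine (congrArg (H.fusionInv e he) (H.tensorMap_orbitHom t a z)).trans ?_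
    refine (H.indMap_orbitHom_smul e he t a z)
  | add x y hx hy =>
    refine (congrArg (H.fusionInv e he) (map_add _ x y)).trans ((map_add _ _ _).trans
      ((congrArg₂ (· + ·) hx hy).trans ?_))
    exact ((congrArg (H.indMap V (orbitHom z)).hom (map_add e.symm x y)).trans
      (map_add _ _ _)).symm

lemma fusionInv_fusion (he : ∀ w, e w = (H.fusion V (ModuleCat.of A A)).hom w)
    (w : H.Induced (V ⊗ H.res.obj Z)) :
    H.fusionInv e he ((H.fusion V Z).hom w) = w := by
  induction w using induced_induction with
  | add x y hx hy =>
    refine (congrArg (H.fusionInv e he) (map_add _ x y)).trans ((map_add _ _ _).trans ?_)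
    rw [hx, hy]
  | tmul a p =>
    induction p using BimodCat.induction_on with
    | tmul v z =>
      -- A generator a ⊗ (v ⊗ z) comes from a ⊗ (v ⊗ 1) over the regular module, where the inverse
      -- is given.
      have h : (H.indMap V (orbitHom (show Z from z))).hom (H.indTmul a
          (BimodCat.tmul (N := H.regular) v (H.toRegular 1))) =
          H.indTmul a (BimodCat.tmul v z) := by
        refine (H.indLift_tmul _ _ _).trans ?_
        change H.indTmul (a * 1) (BimodCat.tmul v (show H.res.obj Z from (1 : A) • (show Z from z))) = _
        rw [mul_one, one_smul]
      rw [← h, fusion_naturality_apply, fusionInv_tensorMap, ← he, e.symm_apply_apply]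
    | add x y hx hy =>
      have h : H.indTmul a (x + y) = H.indTmul a x + H.indTmul a y := BalancedTensor.tmul_add _ _ _
      rw [h]
      refine (congrArg (H.fusionInv e he) (map_add _ _ _)).trans ((map_add _ _ _).trans ?_)
      rw [hx, hy]

end Inverse

/-- Every element of Z is the image of 1 under a map from A, so naturality forces the formula for
the inverse. Here `fusionInv` is only used as a left inverse, as surjectivity has its own argument.
-/
lemma fusion_bijective
    (h : Function.Bijective (H.fusion V (ModuleCat.of A A)).hom) (Z : ModuleCat.{w} A) :
    Function.Bijective (H.fusion V Z).hom :=
  let e : H.Induced (V ⊗ H.regular) ≃+ H.Tensor (H.induced V) (ModuleCat.of A A) :=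
    AddEquiv.ofBijective (H.fusion V (ModuleCat.of A A)).hom.toAddMonoidHom h
  ⟨Function.LeftInverse.injective (H.fusionInv_fusion e fun _ => rfl), fusion_surjective h.2 Z⟩

/-- If the regular module has a right dual, then the bialgebroid is a left Hopf algebroid. -/
lemma isLeftHopf_of_exactPairing (Y : ModuleCat.{w} A)
    (hY : letI := H.monoidalCategory; Nonempty (ExactPairing (ModuleCat.of A A) Y)) :
    H.IsLeftHopf := by
  intro V W
  rw [leftFusion_eq]
  refine H.fusion_bijective ?_ _
  letI := H.monoidalCategory
  letI : H.res.Monoidal := Monoidal.fromInducedMonoidal H.res _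
  obtain ⟨_⟩ := hY
  have e : H.monadUnit _ ≫ H.res.map (H.fusion V (ModuleCat.of A A)) =
      H.monadUnit V ▷ H.regular ≫ (H.tensorIso (H.induced V) (ModuleCat.of A A)).hom :=
    H.monadUnit_indLift _
  -- Restriction to Rᵉ is strong monoidal, and both induced modules are free in the required sense;
  -- the right dual Y is the remaining hypothesis.
  have : IsIso (H.fusion V (ModuleCat.of A A)) :=
    isIso_fusion (U := H.res) Y (H.monadUnit V) (H.monadUnit _) (H.induced_universal _)
      (H.induced_universal _) _ e
  exact ConcreteCategory.bijective_of_isIso (H.fusion V (ModuleCat.of A A))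

end LeftBialgebroid

end Hopf

/-! ### The comonoid Q ⊗ ᘁQ and the two actions of End(Q) on it -/

section InternalEnd

variable {C : Type u} [Category.{w} C] [MonoidalCategory C] (Q : C) [HasLeftDual Q]

/-- The comonoid `Q ⊗ ᘁQ`. -/
@[reducible]
def comonObjTensorDual : ComonObj (Q ⊗ (ᘁQ : C)) where
  counit := ε_ (ᘁQ : C) Q
  comul := 𝟙 _ ⊗≫ Q ◁ η_ (ᘁQ : C) Q ▷ (ᘁQ : C) ⊗≫ 𝟙 _
  counit_comul := by
    calc
      _ = 𝟙 _ ⊗≫ (Q ◁ η_ (ᘁQ : C) Q ⊗≫ ε_ (ᘁQ : C) Q ▷ Q) ▷ (ᘁQ : C) ⊗≫ 𝟙 _ := by monoidal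
      _ = _ := by rw [ExactPairing.coevaluation_evaluation'']; monoidal
  comul_counit := by
    calc
      _ = 𝟙 _ ⊗≫ Q ◁ (η_ (ᘁQ : C) Q ▷ (ᘁQ : C) ⊗≫ (ᘁQ : C) ◁ ε_ (ᘁQ : C) Q) ⊗≫ 𝟙 _ := by monoidal
      _ = _ := by rw [ExactPairing.evaluation_coevaluation'']; monoidal
  -- The two coevaluations are inserted at disjoint places, so coassociativity is the interchange
  -- law.
  comul_assoc := by
    calc
      _ = 𝟙 _ ⊗≫ Q ◁ (η_ (ᘁQ : C) Q ▷ 𝟙_ C ≫ ((ᘁQ : C) ⊗ Q) ◁ η_ (ᘁQ : C) Q) ▷ (ᘁQ : C) ⊗≫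
          𝟙 _ := by monoidal
      _ = _ := by rw [← whisker_exchange]; monoidal

variable [Preadditive C] [MonoidalPreadditive C]

lemma leftAdjointMate_add (f g : Q ⟶ Q) : (ᘁ(f + g)) = (ᘁf) + (ᘁg) := by
  simp only [leftAdjointMate, MonoidalPreadditive.whiskerLeft_add,
    MonoidalPreadditive.add_whiskerRight, Preadditive.add_comp, Preadditive.comp_add]

variable {k : Type w} [CommRing k] [Linear k C] [MonoidalLinear k C]

lemma leftAdjointMate_smul (c : k) (f : Q ⟶ Q) : (ᘁ(c • f)) = c • (ᘁf) := by
  simp only [leftAdjointMate, MonoidalLinear.whiskerLeft_smul,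
    MonoidalLinear.smul_whiskerRight, Linear.comp_smul, Linear.smul_comp]

variable (k) in
/-- The action of the endomorphisms of `Q` on the two factors of `Q ⊗ ᘁQ`. -/
def sourceTargetTensorDual : SourceTarget k (EndOp Q) (EndOp (Q ⊗ (ᘁQ : C))) where
  s := AlgHom.ofLinearMap
    { toFun := fun r => EndOp.of (r.hom ▷ (ᘁQ : C))
      map_add' := fun _ _ => MonoidalPreadditive.add_whiskerRight _ _
      map_smul' := fun _ _ => MonoidalLinear.smul_whiskerRight _ _ _ }
    (id_whiskerRight _ _) (fun _ _ => comp_whiskerRight _ _ _)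
  -- Passing to the adjoint mate reverses composition, which is why the second factor carries an
  -- action of the opposite ring.
  t := AlgHom.ofLinearMap
    { toFun := fun r => EndOp.of (Q ◁ (ᘁ(unop r).hom))
      map_add' := fun _ _ => (congrArg (Q ◁ ·) (leftAdjointMate_add Q _ _)).trans
        (MonoidalPreadditive.whiskerLeft_add _ _)
      map_smul' := fun c _ => (congrArg (Q ◁ ·) (leftAdjointMate_smul Q c _)).trans
        (MonoidalLinear.whiskerLeft_smul _ _ _) }
    ((congrArg (Q ◁ ·) leftAdjointMate_id).trans (whiskerLeft_id _ _))
    (fun _ _ => (congrArg (Q ◁ ·) comp_leftAdjointMate).trans (whiskerLeft_comp _ _ _))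
  commute r r' := (whisker_exchange (EndOp.hom r) (ᘁ(unop r').hom)).symm

lemma sourceTargetTensorDual_s (r : EndOp Q) :
    ((sourceTargetTensorDual Q k).s r).hom = r.hom ▷ (ᘁQ : C) := rfl

lemma sourceTargetTensorDual_t (r : EndOp Q) :
    ((sourceTargetTensorDual Q k).t (op r)).hom = Q ◁ (ᘁr.hom) := rfl

attribute [local instance] comonObjTensorDual

variable (k) in
/-- The compatibility of `sourceTargetTensorDual` with the comonoid structure. -/
def baseTensorDual : ComonoidBase k (EndOp Q) (Q ⊗ (ᘁQ : C)) where
  toSourceTarget := sourceTargetTensorDual Q k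
  -- On the inserted coevaluation, ᘁr on the dual factor equals r on the factor `Q`. The same
  -- sliding rule for the evaluation gives `source_counit`.
  comul_balanced r := by
    rw [sourceTargetTensorDual_s, sourceTargetTensorDual_t]
    change (𝟙 _ ⊗≫ Q ◁ η_ (ᘁQ : C) Q ▷ (ᘁQ : C) ⊗≫ 𝟙 _) ≫ _ =
      (𝟙 _ ⊗≫ Q ◁ η_ (ᘁQ : C) Q ▷ (ᘁQ : C) ⊗≫ 𝟙 _) ≫ _
    calc
      _ = 𝟙 _ ⊗≫ Q ◁ (η_ (ᘁQ : C) Q ≫ (ᘁr.hom) ▷ Q) ▷ (ᘁQ : C) ⊗≫ 𝟙 _ := by monoidal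
      _ = _ := by rw [coevaluation_comp_leftAdjointMate]; monoidal
  source_comul r := by
    rw [sourceTargetTensorDual_s]
    change _ ≫ (𝟙 _ ⊗≫ Q ◁ η_ (ᘁQ : C) Q ▷ (ᘁQ : C) ⊗≫ 𝟙 _) =
      (𝟙 _ ⊗≫ Q ◁ η_ (ᘁQ : C) Q ▷ (ᘁQ : C) ⊗≫ 𝟙 _) ≫ _
    calc
      _ = 𝟙 _ ⊗≫ (r.hom ▷ (𝟙_ C) ≫ Q ◁ η_ (ᘁQ : C) Q) ▷ (ᘁQ : C) ⊗≫ 𝟙 _ := by monoidal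
      _ = _ := by rw [← whisker_exchange]; monoidal
  target_comul r := by
    rw [sourceTargetTensorDual_t]
    change _ ≫ (𝟙 _ ⊗≫ Q ◁ η_ (ᘁQ : C) Q ▷ (ᘁQ : C) ⊗≫ 𝟙 _) =
      (𝟙 _ ⊗≫ Q ◁ η_ (ᘁQ : C) Q ▷ (ᘁQ : C) ⊗≫ 𝟙 _) ≫ _
    calc
      _ = 𝟙 _ ⊗≫ Q ◁ ((𝟙_ C) ◁ (ᘁr.hom) ≫ η_ (ᘁQ : C) Q ▷ (ᘁQ : C)) ⊗≫ 𝟙 _ := by monoidal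
      _ = _ := by rw [whisker_exchange]; monoidal
  source_counit r := by
    rw [sourceTargetTensorDual_s, sourceTargetTensorDual_t]
    exact (leftAdjointMate_comp_evaluation r.hom).symm

end InternalEnd

/-! ### Finite generators and an Eilenberg–Watts argument -/

section Presentation

open Limits

attribute [local instance] Abelian.hasFiniteBiproducts

variable {C : Type u} [Category.{w} C] [Abelian C]

/-- An object `Q` such that every object is a quotient of a finite direct sum of copies of `Q`. -/
def IsFiniteGenerator (Q : C) : Prop :=
  ∀ X : C, ∃ (n : ℕ) (π : (⨁ fun _ : Fin n => Q) ⟶ X), Epi π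

/-- A finite k-basis of Hom(Q, X) defines an epimorphism: a morphism out of X that kills the basis
kills all of Hom(Q, X) by linearity, and so vanishes because `Q` separates. -/
lemma IsFiniteGenerator.of_isSeparator {k : Type w} [Field k] [Linear k C] {Q : C}
    (hQ : IsSeparator Q) (hfin : ∀ X : C, Module.Finite k (Q ⟶ X)) : IsFiniteGenerator Q := by
  intro X
  have := hfin X
  let b := Module.finBasis k (Q ⟶ X)
  refine ⟨_, biproduct.desc fun i => b i, Preadditive.epi_of_cancel_zero _ fun {Y} g hg => ?_⟩
  have h : ∀ i, b i ≫ g = 0 := fun i => by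
    rw [← biproduct.ι_desc (fun i => b i) i, Category.assoc, hg, comp_zero]
  have hl : Linear.rightComp k Q g = 0 := b.ext fun i => h i
  refine hQ.def _ _ fun f => ?_
  rw [comp_zero]
  exact LinearMap.congr_fun hl f

lemma biproduct_sum {n : ℕ} {Q X Z : C} (φ : X ⟶ ⨁ fun _ : Fin n => Q)
    (ψ : (⨁ fun _ : Fin n => Q) ⟶ Z) :
    φ ≫ ψ = ∑ j, (φ ≫ biproduct.π _ j) ≫ biproduct.ι (fun _ : Fin n => Q) j ≫ ψ := by
  conv_lhs => rw [← Category.id_comp ψ, ← biproduct.total]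
  simp only [Preadditive.comp_sum, Preadditive.sum_comp, Category.assoc]

variable {F : C ⥤ C} [F.Additive]

lemma map_biproduct_sum {n : ℕ} {Q X Z : C} (φ : X ⟶ F.obj (⨁ fun _ : Fin n => Q))
    (ψ : (⨁ fun _ : Fin n => Q) ⟶ Z) :
    φ ≫ F.map ψ = ∑ j, (φ ≫ F.map (biproduct.π _ j)) ≫
      F.map (biproduct.ι (fun _ : Fin n => Q) j ≫ ψ) := by
  conv_lhs => rw [← Category.id_comp ψ, ← biproduct.total]
  simp only [Preadditive.comp_sum, Preadditive.sum_comp, F.map_sum, F.map_comp, Category.assoc]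

/-- A right exact functor `F` is determined on Hom's out of a projective generator `Q` by the
balanced tensor product with `Hom(Q, F Q)`. -/
lemma bijective_of_balanced [PreservesFiniteColimits F] {Q Z : C} [Projective Q]
    (hQ : IsFiniteGenerator Q) {T : Type*} [AddCommGroup T]
    (τ : (Q ⟶ F.obj Q) →+ (Q ⟶ Z) →+ T)
    (hbal : ∀ f (r : Q ⟶ Q) g, τ (f ≫ F.map r) g = τ f (r ≫ g))
    (hind : ∀ p : T → Prop, (∀ f g, p (τ f g)) → (∀ x y, p x → p y → p (x + y)) → ∀ t, p t)
    (c : T →+ (Q ⟶ F.obj Z)) (hc : ∀ f g, c (τ f g) = f ≫ F.map g) :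
    Function.Bijective c := by
  obtain ⟨n, π, _⟩ := hQ Z
  let pj (j : Fin n) : Q ⟶ Z := biproduct.ι (fun _ : Fin n => Q) j ≫ π
  constructor
  -- Lifting g through Qⁿ → Z writes it as a combination of the fixed morphisms `pj j`, and
  -- balancing moves the coefficients into the first factor. An element is thus encoded by one φ,
  -- and `c` sends it to φ ≫ F(π).
  · have key : ∀ t, ∃ φ : Q ⟶ F.obj (⨁ fun _ : Fin n => Q),
        t = ∑ j, τ (φ ≫ F.map (biproduct.π _ j)) (pj j) := by
      refine hind _ (fun f g => ⟨f ≫ F.map (Projective.factorThru g π), ?_⟩) ?_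
      · conv_lhs => rw [← Projective.factorThru_comp g π, biproduct_sum, map_sum]
        refine Finset.sum_congr rfl fun j _ => ?_
        rw [← hbal, F.map_comp, Category.assoc]
      · rintro x y ⟨φ, rfl⟩ ⟨ψ, rfl⟩
        refine ⟨φ + ψ, ?_⟩
        simp [Finset.sum_add_distrib]
    rw [injective_iff_map_eq_zero]
    intro t ht
    obtain ⟨φ, rfl⟩ := key t
    have hφ : φ ≫ F.map π = 0 := by
      rw [map_biproduct_sum, ← ht, map_sum]
      exact Finset.sum_congr rfl fun j _ => (hc _ _).symm
    let S := ShortComplex.mk (kernel.ι π) π (kernel.condition π)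
    have hS : S.Exact := ShortComplex.exact_of_f_is_kernel _ (kernelIsKernel π)
    -- Right exactness of F and projectivity of `Q` let φ, which F(π) kills, factor through F(ker π)
    -- and then through F(Qᵐ), where Qᵐ covers ker π.
    have hFS : (S.map F).Exact := hS.map_of_epi_of_preservesCokernel F inferInstance inferInstance
    obtain ⟨m, ρ, _⟩ := hQ (kernel π)
    let ψ : Q ⟶ F.obj (kernel π) := hFS.liftFromProjective φ hφ
    have hψ : ψ ≫ F.map (kernel.ι π) = φ := hFS.liftFromProjective_comp φ hφ
    let χ := Projective.factorThru ψ (F.map ρ)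
    have hχ : χ ≫ F.map ρ = ψ := Projective.factorThru_comp ψ (F.map ρ)
    -- The matrix entries of Qᵐ → ker π → Qⁿ are moved across the balancing. Summing over j
    -- reassembles the composite of ker π → Qⁿ with π, which is zero.
    have e (j : Fin n) : τ (φ ≫ F.map (biproduct.π _ j)) (pj j) =
        ∑ l, τ (χ ≫ F.map (biproduct.π _ l)) (((biproduct.ι (fun _ : Fin m => Q) l ≫ ρ ≫
          kernel.ι π) ≫ biproduct.π _ j) ≫ pj j) := by
      rw [← hψ, ← hχ, Category.assoc, Category.assoc, ← F.map_comp, ← F.map_comp,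
        map_biproduct_sum, map_sum, AddMonoidHom.finsetSum_apply]
      exact Finset.sum_congr rfl fun l _ => by rw [hbal]; simp only [Category.assoc]
    rw [Finset.sum_congr rfl fun j _ => e j, Finset.sum_comm]
    refine Finset.sum_eq_zero fun l _ => ?_
    rw [← map_sum, ← biproduct_sum]
    simp
  · intro f
    let φ := Projective.factorThru f (F.map π)
    refine ⟨∑ j, τ (φ ≫ F.map (biproduct.π _ j)) (pj j), ?_⟩
    rw [map_sum, ← Projective.factorThru_comp f (F.map π), map_biproduct_sum]
    exact Finset.sum_congr rfl fun j _ => hc _ _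

end Presentation

/-! ### Hom(P, -) is an equivalence for a projective generator P -/

section Equivalence

open Limits
open scoped ModuleCat

attribute [local instance] Abelian.hasFiniteBiproducts

variable {C : Type u} [Category.{w} C] [Abelian C] {k : Type w} [Field k] [Linear k C] {P : C}

lemma EndOp.faithful_coyoneda (hs : IsSeparator P) : (EndOp.coyoneda P).Faithful where
  map_injective {X _ _ _} h := hs.def _ _ fun t =>
    congrArg (fun φ => φ.hom (show (EndOp.coyoneda P).obj X from t)) h

/-- Evaluating φ on the components of an epimorphism Pⁿ → X gives a morphism Pⁿ → Y. Linearity of φ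
and the separator property show that it kills the kernel, so it descends to X; projectivity shows
that the result induces φ. -/
lemma EndOp.full_coyoneda [Projective P] (hs : IsSeparator P) (hP : IsFiniteGenerator P) :
    (EndOp.coyoneda P).Full where
  map_surjective {X Y} φ := by
    obtain ⟨n, π, _⟩ := hP X
    let ev (f : P ⟶ X) : P ⟶ Y := φ.hom (show (EndOp.coyoneda P).obj X from f)
    have ev_add (f g) : ev (f + g) = ev f + ev g := φ.hom.map_add _ _
    have ev_comp (a : P ⟶ P) (f) : ev (a ≫ f) = a ≫ ev f := φ.hom.map_smul (EndOp.of a) f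
    have ev_sum (a : Fin n → (P ⟶ X)) : ev (∑ j, a j) = ∑ j, ev (a j) :=
      map_sum (AddMonoidHom.mk' ev ev_add) _ _
    let ψ : (⨁ fun _ : Fin n => P) ⟶ Y :=
      biproduct.desc fun j => ev (biproduct.ι (fun _ : Fin n => P) j ≫ π)
    have hψ (h : P ⟶ ⨁ fun _ : Fin n => P) : h ≫ ψ = ev (h ≫ π) := by
      rw [biproduct_sum h π, biproduct_sum h ψ, ev_sum]
      exact Finset.sum_congr rfl fun j _ => by rw [ev_comp, biproduct.ι_desc]
    have hk : kernel.ι π ≫ ψ = 0 := hs.def _ _ fun h => by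
      rw [← Category.assoc, hψ, Category.assoc, kernel.condition, comp_zero, comp_zero]
      exact φ.hom.map_zero
    let c := Abelian.epiIsCokernelOfKernel _ (kernelIsKernel π)
    let f : X ⟶ Y := c.desc (CokernelCofork.ofπ ψ hk)
    have hf : π ≫ f = ψ := c.fac (CokernelCofork.ofπ ψ hk) WalkingParallelPair.one
    refine ⟨f, ?_⟩
    ext h
    change (show P ⟶ X from h) ≫ f = ev h
    rw [← Projective.factorThru_comp (show P ⟶ X from h) π, Category.assoc, hf, hψ]

/-- A finite presentation Aᵐ → Aⁿ → M is also a matrix Pᵐ → Pⁿ, and X is its cokernel. Since `P` is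
projective, Hom(P, X) is the quotient of Hom(P, Pⁿ) = Aⁿ by the same relations. -/
lemma EndOp.exists_iso_coyoneda [Projective P] [IsNoetherianRing (EndOp P)]
    (M : ModuleCat.{w} (EndOp P)) [Module.Finite (EndOp P) M] :
    ∃ X : C, Nonempty ((EndOp.coyoneda P).obj X ≅ M) := by
  obtain ⟨n, p, hp⟩ := Module.Finite.exists_fin' (EndOp P) M
  obtain ⟨m, q, hq⟩ := Module.Finite.exists_fin' (EndOp P) (LinearMap.ker p)
  let toHom : (Fin n → EndOp P) ≃ (P ⟶ ⨁ fun _ : Fin n => P) :=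
    { toFun := fun b => biproduct.lift fun j => (b j).hom
      invFun := fun f j => EndOp.of (f ≫ biproduct.π _ j)
      left_inv := fun b => funext fun j => biproduct.lift_π _ _
      right_inv := fun f => biproduct.hom_ext _ _ fun j => biproduct.lift_π _ _ }
  have toHom_π (b : Fin n → EndOp P) (j) : toHom b ≫ biproduct.π _ j = (b j).hom :=
    biproduct.lift_π _ _
  have toHom_add (b b' : Fin n → EndOp P) : toHom (b + b') = toHom b + toHom b' :=
    biproduct.hom_ext _ _ fun j => by
      rw [Preadditive.add_comp, toHom_π, toHom_π, toHom_π]; rfl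
  have toHom_smul (a : EndOp P) (b : Fin n → EndOp P) : toHom (a • b) = a.hom ≫ toHom b :=
    biproduct.hom_ext _ _ fun j => by
      rw [Category.assoc, toHom_π, toHom_π]; rfl
  have toHom_sum (b : Fin m → (Fin n → EndOp P)) : toHom (∑ l, b l) = ∑ l, toHom (b l) :=
    map_sum (AddMonoidHom.mk' toHom toHom_add) _ _
  let rel (l : Fin m) : Fin n → EndOp P := (q (Pi.single l 1) : LinearMap.ker p)
  let a : (⨁ fun _ : Fin m => P) ⟶ (⨁ fun _ : Fin n => P) := biproduct.desc fun l => toHom (rel l)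
  let X := cokernel a
  let Θ : (Fin n → EndOp P) →ₗ[EndOp P] (EndOp.coyoneda P).obj X :=
    { toFun := fun b => (show P ⟶ X from toHom b ≫ cokernel.π a)
      map_add' := fun b b' => by rw [toHom_add, Preadditive.add_comp]; rfl
      map_smul' := fun s b => by rw [toHom_smul, Category.assoc]; rfl }
  have hΘ : Function.Surjective Θ := fun f =>
    ⟨toHom.symm (Projective.factorThru (show P ⟶ X from f) (cokernel.π a)), by
      change toHom (toHom.symm _) ≫ cokernel.π a = f
      rw [Equiv.apply_symm_apply, Projective.factorThru_comp]⟩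
  have hq_sum (c : Fin m → EndOp P) : (q c : Fin n → EndOp P) = ∑ l, c l • rel l := by
    conv_lhs => rw [pi_eq_sum_univ' c, map_sum]
    simp only [map_smul]
    push_cast
    rfl
  have hker : LinearMap.ker p = LinearMap.ker Θ := by
    apply le_antisymm
    · intro b hb
      obtain ⟨c, hc⟩ := hq ⟨b, hb⟩
      have hb' : b = ∑ l, c l • rel l := by rw [← hq_sum, hc]
      change toHom b ≫ cokernel.π a = 0
      rw [hb', toHom_sum, Preadditive.sum_comp]
      refine Finset.sum_eq_zero fun l _ => ?_
      have : toHom (rel l) ≫ cokernel.π a = 0 := by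
        rw [← biproduct.ι_desc (fun l => toHom (rel l)) l, Category.assoc, cokernel.condition,
          comp_zero]
      rw [toHom_smul, Category.assoc, this, comp_zero]
    · intro b hb
      have hb' : toHom b ≫ cokernel.π a = 0 := hb
      let S := ShortComplex.mk a (cokernel.π a) (cokernel.condition a)
      have hS : S.Exact := ShortComplex.exact_of_g_is_cokernel _ (cokernelIsCokernel a)
      -- The coordinates of this lift through Pᵐ are the coefficients that express b by the
      -- relations.
      let d : P ⟶ ⨁ fun _ : Fin m => P := hS.liftFromProjective (toHom b) hb'
      have hd : d ≫ a = toHom b := hS.liftFromProjective_comp (toHom b) hb'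
      have : b = ∑ l, EndOp.of (d ≫ biproduct.π _ l) • rel l := by
        apply toHom.injective
        rw [← hd, biproduct_sum, toHom_sum]
        exact Finset.sum_congr rfl fun l _ => by rw [toHom_smul, biproduct.ι_desc]; rfl
      rw [this]
      exact Submodule.sum_mem _ fun l _ => Submodule.smul_mem _ _ (q (Pi.single l 1)).2
  exact ⟨X, ⟨((LinearMap.quotKerEquivOfSurjective Θ hΘ).symm.trans
    ((Submodule.quotEquivOfEq _ _ hker.symm).trans
      (LinearMap.quotKerEquivOfSurjective p hp))).toModuleIso⟩⟩

variable (k) in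
lemma EndOp.isEquivalence_coyonedaFD [∀ X : C, Module.Finite k (P ⟶ X)] [Projective P]
    (hs : IsSeparator P) : (EndOp.coyonedaFD k P).IsEquivalence := by
  have := EndOp.faithful_coyoneda hs
  have := EndOp.full_coyoneda hs (.of_isSeparator (k := k) hs inferInstance)
  have : Module.Finite k (EndOp P) := inferInstanceAs (Module.Finite k (P ⟶ P))
  have : IsNoetherianRing (EndOp P) := isNoetherian_of_tower k inferInstance
  have h₁ : (EndOp.coyonedaFD k P).Faithful := inferInstanceAs
    (((isFiniteDimensional k (EndOp P)).lift (EndOp.coyoneda P)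
      (EndOp.finite_coyoneda k P)).Faithful)
  have h₂ : (EndOp.coyonedaFD k P).Full := inferInstanceAs
    (((isFiniteDimensional k (EndOp P)).lift (EndOp.coyoneda P) (EndOp.finite_coyoneda k P)).Full)
  refine { faithful := h₁, full := h₂, essSurj := ⟨fun M => ?_⟩ }
  have : Module.Finite k M.obj := M.property
  have : Module.Finite (EndOp P) M.obj := .of_restrictScalars_finite k _ _
  obtain ⟨X, ⟨i⟩⟩ := EndOp.exists_iso_coyoneda M.obj
  exact ⟨X, ⟨(isFiniteDimensional k (EndOp P)).isoMk i⟩⟩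

end Equivalence

/-! ### The fibre functor in the form Hom(Q, X ⊗ Q) -/

section Reconstruction

open Limits

variable {C : Type u} [Category.{w} C] [MonoidalCategory C] (Q : C) [HasLeftDual Q]

/-- Morphisms out of `Q ⊗ ᘁQ` as morphisms out of `Q`. -/
def tensorDualHomEquiv (X : C) : (Q ⊗ (ᘁQ : C) ⟶ X) ≃ (Q ⟶ X ⊗ Q) :=
  tensorRightHomEquiv Q (ᘁQ : C) Q X

lemma tensorDualHomEquiv_apply {X : C} (f : Q ⊗ (ᘁQ : C) ⟶ X) : tensorDualHomEquiv Q X f =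
    (ρ_ Q).inv ≫ Q ◁ η_ (ᘁQ : C) Q ≫ (α_ Q (ᘁQ) Q).inv ≫ f ▷ Q := rfl

lemma tensorDualHomEquiv_symm_apply {X : C} (f : Q ⟶ X ⊗ Q) : (tensorDualHomEquiv Q X).symm f =
    f ▷ (ᘁQ : C) ≫ (α_ X Q (ᘁQ)).hom ≫ X ◁ ε_ (ᘁQ : C) Q ≫ (ρ_ X).hom := rfl

lemma tensorDualHomEquiv_symm_comp {X : C} (r : Q ⟶ Q) (f : Q ⟶ X ⊗ Q) :
    (tensorDualHomEquiv Q X).symm (r ≫ f) = r ▷ (ᘁQ : C) ≫ (tensorDualHomEquiv Q X).symm f :=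
  tensorRightHomEquiv_symm_naturality r f

attribute [local instance] comonObjTensorDual

/-- This translates the right action of End(Q): on Hom(Q, X ⊗ Q) it acts on the target copy of `Q`,
while `tensorDualHomEquiv_symm_comp` shows that the left action is precomposition. -/
lemma tensorDualHomEquiv_symm_whiskerLeft {X : C} (f : Q ⟶ X ⊗ Q) (r : Q ⟶ Q) :
    (tensorDualHomEquiv Q X).symm (f ≫ X ◁ r) = Q ◁ (ᘁr) ≫ (tensorDualHomEquiv Q X).symm f := by
  simp only [tensorDualHomEquiv_symm_apply]
  calc
    _ = f ▷ (ᘁQ : C) ⊗≫ X ◁ (r ▷ (ᘁQ : C) ≫ ε_ (ᘁQ : C) Q) ⊗≫ 𝟙 _ := by monoidal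
    _ = (f ▷ (ᘁQ : C) ≫ (X ⊗ Q) ◁ (ᘁr)) ⊗≫ X ◁ ε_ (ᘁQ : C) Q ⊗≫ 𝟙 _ := by
      rw [← leftAdjointMate_comp_evaluation]; monoidal
    _ = _ := by rw [← whisker_exchange]; monoidal

lemma tensorDualHomEquiv_symm_unit (r : Q ⟶ Q) :
    (tensorDualHomEquiv Q (𝟙_ C)).symm (r ≫ (λ_ Q).inv) = r ▷ (ᘁQ : C) ≫ ε_ (ᘁQ : C) Q := by
  simp only [tensorDualHomEquiv_symm_apply]
  monoidal

/-- The coevaluation in the comultiplication feeds the output `Q` of the first morphism into the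
second. The proof only interchanges the two coevaluations with each other and then one of them with
f. It puts convolution in the shape required by `bijective_of_balanced`. -/
lemma tensorDualHomEquiv_conv {X Z : C} (f : Q ⊗ (ᘁQ : C) ⟶ X) (g : Q ⊗ (ᘁQ : C) ⟶ Z) :
    tensorDualHomEquiv Q (X ⊗ Z) (conv f g) ≫ (α_ X Z Q).hom =
      tensorDualHomEquiv Q X f ≫ X ◁ tensorDualHomEquiv Q Z g := by
  have h : conv f g =
      (𝟙 _ ⊗≫ Q ◁ η_ (ᘁQ : C) Q ▷ (ᘁQ : C) ⊗≫ 𝟙 _) ≫ f ▷ (Q ⊗ (ᘁQ : C)) ≫ X ◁ g :=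
    congrArg _ (MonoidalCategory.tensorHom_def f g)
  simp only [tensorDualHomEquiv_apply, h]
  calc
    _ = 𝟙 _ ⊗≫ Q ◁ (𝟙_ C ◁ η_ (ᘁQ : C) Q ≫ η_ (ᘁQ : C) Q ▷ ((ᘁQ : C) ⊗ Q)) ⊗≫
        f ▷ (Q ⊗ (ᘁQ : C) ⊗ Q) ⊗≫ X ◁ g ▷ Q ⊗≫ 𝟙 _ := by monoidal
    _ = 𝟙 _ ⊗≫ Q ◁ η_ (ᘁQ : C) Q ⊗≫ (((Q ⊗ (ᘁQ : C)) ◁ (Q ◁ η_ (ᘁQ : C) Q)) ≫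
        f ▷ (Q ⊗ (ᘁQ : C) ⊗ Q)) ⊗≫ X ◁ g ▷ Q ⊗≫ 𝟙 _ := by
      rw [whisker_exchange]; monoidal
    _ = _ := by rw [whisker_exchange]; monoidal

variable [Preadditive C] [MonoidalPreadditive C]

lemma tensorDualHomEquiv_symm_add {X : C} (f g : Q ⟶ X ⊗ Q) :
    (tensorDualHomEquiv Q X).symm (f + g) =
      (tensorDualHomEquiv Q X).symm f + (tensorDualHomEquiv Q X).symm g := by
  simp only [tensorDualHomEquiv_symm_apply]
  rw [MonoidalPreadditive.add_whiskerRight, Preadditive.add_comp]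

lemma tensorDualHomEquiv_add {X : C} (f g : Q ⊗ (ᘁQ : C) ⟶ X) :
    tensorDualHomEquiv Q X (f + g) = tensorDualHomEquiv Q X f + tensorDualHomEquiv Q X g := by
  apply (tensorDualHomEquiv Q X).symm.injective
  rw [tensorDualHomEquiv_symm_add]
  simp only [Equiv.symm_apply_apply]

end Reconstruction

/-! ### The unit and tensor constraints are bijective -/

section Bijectivity

open Limits

variable {C : Type u} [Category.{w} C] [Abelian C] [MonoidalCategory C] [MonoidalPreadditive C]
  {k : Type w} [CommRing k] [Linear k C] [MonoidalLinear k C] (Q : C) [HasLeftDual Q]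

attribute [local instance] comonObjTensorDual

lemma bijective_baseTensorDual_unit : Function.Bijective (baseTensorDual Q k).unit.hom := by
  have h : ⇑(baseTensorDual Q k).unit.hom = fun r : UnitBimod k (EndOp Q) =>
      (baseTensorDual Q k).elt
        ((tensorDualHomEquiv Q (𝟙_ C)).symm ((λ_ Q).symm.homToEquiv r.val.hom)) :=
    funext fun r => (tensorDualHomEquiv_symm_unit Q _).symm
  rw [h]
  exact ((λ_ Q).symm.homToEquiv.trans (tensorDualHomEquiv Q (𝟙_ C)).symm).bijective

lemma bijective_baseTensorDual_mul [Projective Q] (hQ : IsFiniteGenerator Q) (X Z : C)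
    [Limits.PreservesFiniteColimits (tensorLeft X)] :
    Function.Bijective ((baseTensorDual Q k).mul X Z).hom := by
  let B := baseTensorDual Q k
  let e (Y : C) := tensorDualHomEquiv Q Y
  let τ : (Q ⟶ (tensorLeft X).obj Q) →+ (Q ⟶ Z ⊗ Q) →+
      (B.fiber.obj X ⊗ B.fiber.obj Z : BimodCat k (EndOp Q)) :=
    AddMonoidHom.mk' (fun f => AddMonoidHom.mk' (fun g => BimodCat.tmul
      (B.elt ((e X).symm f)) (B.elt ((e Z).symm g)))
      fun g g' => (congrArg _ (tensorDualHomEquiv_symm_add Q g g')).trans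
        (BimodCat.tmul_add _ _ _))
      fun f f' => AddMonoidHom.ext fun g =>
        (congrArg (fun x => BimodCat.tmul (B.elt x) (B.elt ((e Z).symm g)))
          (tensorDualHomEquiv_symm_add Q f f')).trans (BimodCat.add_tmul _ _ _)
  let c : (B.fiber.obj X ⊗ B.fiber.obj Z : BimodCat k (EndOp Q)) →+ (Q ⟶ X ⊗ (Z ⊗ Q)) :=
    AddMonoidHom.mk' (fun z => e (X ⊗ Z) (show Q ⊗ (ᘁQ : C) ⟶ X ⊗ Z from (B.mul X Z).hom z) ≫
      (α_ X Z Q).hom) fun z z' => by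
        rw [← Preadditive.add_comp]
        exact congrArg (· ≫ (α_ X Z Q).hom) ((congrArg (e (X ⊗ Z)) (map_add _ z z')).trans
          (tensorDualHomEquiv_add Q _ _))
  -- The Eilenberg–Watts lemma is applied to the functor X ⊗ - and the object Z ⊗ Q.
  have hb : Function.Bijective c := by
    refine bijective_of_balanced (F := tensorLeft X) hQ τ (fun f r g => ?_) (fun p h₁ h₂ t => ?_) c
      fun f g => ?_
    · change BimodCat.tmul (B.elt ((e X).symm (f ≫ X ◁ r))) (B.elt ((e Z).symm g)) =
        BimodCat.tmul (B.elt ((e X).symm f)) (B.elt ((e Z).symm (r ≫ g)))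
      rw [tensorDualHomEquiv_symm_whiskerLeft, tensorDualHomEquiv_symm_comp]
      refine (congrArg (fun x => BimodCat.tmul x _) (B.right_smul (EndOp.of r) _).symm).trans ?_
      exact (BimodTensor.smul_tmul _ _ _).trans
        (congrArg (fun x => BimodCat.tmul _ x) (B.left_smul (EndOp.of r) _))
    · induction t using BimodCat.induction_on with
      | add x y hx hy => exact h₂ x y hx hy
      | tmul m n =>
        exact (congrArg₂ (fun x y => p (BimodCat.tmul (B.elt x) (B.elt y)))
          ((e X).symm_apply_apply m) ((e Z).symm_apply_apply n)).mp (h₁ (e X m) (e Z n))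
    · refine (tensorDualHomEquiv_conv Q _ _).trans ?_
      exact congrArg₂ (fun x y => x ≫ X ◁ y) ((e X).apply_symm_apply f) ((e Z).apply_symm_apply g)
  let e' : (Q ⊗ (ᘁQ : C) ⟶ X ⊗ Z) ≃ (Q ⟶ X ⊗ (Z ⊗ Q)) := (e (X ⊗ Z)).trans (α_ X Z Q).homToEquiv
  exact (Function.Bijective.of_comp_iff' e'.bijective _).1 hb

end Bijectivity

/-! ### Q ⊗ ᘁQ is a projective generator -/

section Generator

open Limits

variable {C : Type u} [Category.{w} C] [MonoidalCategory C] (Q : C)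

lemma preservesFiniteColimits_tensorLeft (X : C) [HasLeftDual X] :
    PreservesFiniteColimits (tensorLeft X) :=
  have : PreservesColimitsOfSize.{0, 0} (tensorLeft X) :=
    (tensorLeftAdjunction (ᘁX : C) X).leftAdjoint_preservesColimits
  inferInstance

/-- The functor - ⊗ ᘁQ is left adjoint to - ⊗ Q, which preserves epimorphisms because the right dual
makes it a left adjoint too. Hence - ⊗ ᘁQ preserves projectives. -/
lemma projective_tensorDual [HasLeftDual Q] [HasRightDual Q] [Projective Q] :
    Projective (Q ⊗ (ᘁQ : C)) :=
  have : (tensorRight Q).IsLeftAdjoint := (tensorRightAdjunction Q (Qᘁ : C)).isLeftAdjoint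
  (tensorRightAdjunction (ᘁQ : C) Q).map_projective Q inferInstance

variable [Abelian C] [MonoidalPreadditive C]

attribute [local instance] Abelian.hasFiniteBiproducts

/-- Tensoring an epimorphism Qⁿ → 𝟙 with X keeps it epi. Naturality then recovers f ▷ 𝟙, hence f,
from n copies of f ▷ Q. -/
lemma whiskerRight_injective_of_isFiniteGenerator (hQ : IsFiniteGenerator Q) {X Y : C}
    [HasLeftDual X] {f g : X ⟶ Y} (h : f ▷ Q = g ▷ Q) : f = g := by
  obtain ⟨n, π, _⟩ := hQ (𝟙_ C)
  have : (tensorLeft X).IsLeftAdjoint := (tensorLeftAdjunction (ᘁX : C) X).isLeftAdjoint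
  have : Epi (X ◁ π) := inferInstanceAs (Epi ((tensorLeft X).map π))
  have key (f : X ⟶ Y) : X ◁ π ≫ f ▷ 𝟙_ C = ∑ j, (X ◁ biproduct.π (fun _ : Fin n => Q) j ≫ f ▷ Q) ≫
      Y ◁ (biproduct.ι (fun _ : Fin n => Q) j ≫ π) := by
    rw [whisker_exchange]
    refine (map_biproduct_sum (F := tensorLeft Y) (f ▷ _) π).trans ?_
    exact Finset.sum_congr rfl fun j _ => congrArg (· ≫ _) (whisker_exchange _ _).symm
  have e : f ▷ 𝟙_ C = g ▷ 𝟙_ C := by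
    rw [← cancel_epi (X ◁ π), key, key, h]
  simpa using e

/-- Since Hom(Q ⊗ ᘁQ, X) ≅ Hom(Q, X ⊗ Q) naturally, the claim combines the separator `Q` with
faithfulness of - ⊗ Q. -/
lemma isSeparator_tensorDual [HasLeftDual Q] (hs : IsSeparator Q) (hQ : IsFiniteGenerator Q)
    [∀ X : C, HasLeftDual X] : IsSeparator (Q ⊗ (ᘁQ : C)) := by
  rw [isSeparator_def]
  intro X Y f g h
  refine whiskerRight_injective_of_isFiniteGenerator Q hQ (hs.def _ _ fun u => ?_)
  obtain ⟨u, rfl⟩ := (tensorDualHomEquiv Q X).surjective u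
  have e (f : X ⟶ Y) : tensorDualHomEquiv Q X u ≫ f ▷ Q = tensorDualHomEquiv Q Y (u ≫ f) :=
    (tensorRightHomEquiv_naturality u f).symm
  rw [e, e, h]

variable {k : Type w} [Field k] [Linear k C] [MonoidalLinear k C]

lemma finite_tensorDual_hom [HasLeftDual Q] (hfin : ∀ X : C, Module.Finite k (Q ⟶ X)) (X : C) :
    Module.Finite k (Q ⊗ (ᘁQ : C) ⟶ X) :=
  have := hfin (X ⊗ Q)
  Module.Finite.of_surjective
    ({ toFun := (tensorDualHomEquiv Q X).symm
       map_add' := tensorDualHomEquiv_symm_add Q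
       map_smul' := fun c f => by
        simp only [tensorDualHomEquiv_symm_apply, MonoidalLinear.smul_whiskerRight,
          Linear.smul_comp, RingHom.id_apply] } : (Q ⟶ X ⊗ Q) →ₗ[k] (Q ⊗ (ᘁQ : C) ⟶ X))
    (tensorDualHomEquiv Q X).symm.surjective

attribute [local instance] comonObjTensorDual

/-- A tensor category with a projective generator is the category of finite-dimensional modules
over a finite-dimensional left Hopf algebroid. -/
theorem exists_leftHopf_of_projective_separator [RigidCategory C] [Projective Q]
    (hs : IsSeparator Q) (hfin : ∀ X : C, Module.Finite k (Q ⟶ X)) :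
    ∃ (R : Type w) (_ : Ring R) (_ : Algebra k R) (_ : Module.Finite k R)
      (A : Type w) (_ : Ring A) (_ : Algebra k A) (_ : Module.Finite k A)
      (H : LeftBialgebroid k R A), H.IsLeftHopf ∧
      ∃ E : C ≌ H.FDMod,
        E.functor.Additive ∧ E.functor.Linear k ∧ Nonempty E.functor.Monoidal := by
  have hQ : IsFiniteGenerator Q := .of_isSeparator (k := k) hs hfin
  let P : C := Q ⊗ (ᘁQ : C)
  have hP : ∀ X : C, Module.Finite k (P ⟶ X) := finite_tensorDual_hom Q hfin
  have : Projective P := projective_tensorDual Q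
  have : Module.Finite k (EndOp Q) := hfin Q
  have : Module.Finite k (EndOp P) := hP P
  let B : ComonoidBase k (EndOp Q) P := baseTensorDual Q k
  have hunit : Function.Bijective B.unit.hom := bijective_baseTensorDual_unit Q
  have hmul (X Z : C) : Function.Bijective (B.mul X Z).hom :=
    have := preservesFiniteColimits_tensorLeft X
    bijective_baseTensorDual_mul Q hQ X Z
  refine ⟨EndOp Q, inferInstance, inferInstance, inferInstance, EndOp P, inferInstance,
    inferInstance, inferInstance, B.bialgebroid hunit hmul, ?_, ?_⟩
  · letI := (B.bialgebroid hunit hmul).monoidalCategory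
    letI := (B.coyonedaCore hunit hmul).toMonoidal
    -- The regular A-module is Hom(P, P), so the image of a right dual of `P` is a right dual of it.
    exact LeftBialgebroid.isLeftHopf_of_exactPairing _ ((EndOp.coyoneda P).obj (Pᘁ : C))
      ⟨exactPairingMap (EndOp.coyoneda P) P (Pᘁ : C)⟩
  · have : (B.toFDMod hunit hmul).IsEquivalence :=
      EndOp.isEquivalence_coyonedaFD k (isSeparator_tensorDual Q hs hQ)
    exact ⟨(B.toFDMod hunit hmul).asEquivalence,
      inferInstanceAs (EndOp.coyonedaFD k P).Additive,
      inferInstanceAs ((EndOp.coyonedaFD k P).Linear k), ⟨B.toFDModMonoidal hunit hmul⟩⟩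

end Generator

/-! ### The regular module as a projective generator -/

section FiniteModules

open Limits
open scoped ModuleCat

variable {k : Type w} [Field k] {S : Type w} [Ring S] [Algebra k S]

lemma isFiniteDimensional_of_surjective {V : Type w} [AddCommGroup V] [Module k V]
    [Module.Finite k V] {M : ModuleCat.{w} S} (g : V →+ M)
    (hg : ∀ (c : k) v, g (c • v) = algebraMap k S c • g v) (hs : Function.Surjective g) :
    isFiniteDimensional k S M :=
  Module.Finite.of_surjective ({ g with map_smul' := hg } : V →ₗ[k] M) hs

variable (k S) in
/-- The regular module of a finite-dimensional algebra. -/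
def FDModCat.regular [Module.Finite k S] : FDModCat k S :=
  ⟨ModuleCat.of S S, isFiniteDimensional_of_surjective (AddMonoidHom.id S)
    (fun c s => Algebra.smul_def c s) Function.surjective_id⟩

/-- The quotient of N by the image of f is still finite-dimensional, so f can be tested against it
inside the category. -/
lemma FDModCat.surjective_of_epi {M N : FDModCat k S} (f : M ⟶ N) [Epi f] :
    Function.Surjective f.hom.hom := by
  have : Module.Finite k N.obj := N.property
  let T : FDModCat k S := ⟨ModuleCat.of S (N.obj ⧸ LinearMap.range f.hom.hom),
    isFiniteDimensional_of_surjective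
      (M := ModuleCat.of S (N.obj ⧸ LinearMap.range f.hom.hom))
      (LinearMap.range f.hom.hom).mkQ.toAddMonoidHom
      (fun c s => LinearMap.map_smul (LinearMap.range f.hom.hom).mkQ (algebraMap k S c) s)
      (Submodule.mkQ_surjective _)⟩
  let g : N ⟶ T := ObjectProperty.homMk (show N.obj ⟶ ModuleCat.of S _ from
    ModuleCat.ofHom (LinearMap.range f.hom.hom).mkQ)
  have hg : g = 0 := by
    rw [← cancel_epi f, comp_zero]
    ext x
    exact (Submodule.Quotient.mk_eq_zero (LinearMap.range f.hom.hom)).2 ⟨x, rfl⟩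
  intro y
  have := congrArg (fun h => h.hom.hom y) hg
  exact (Submodule.Quotient.mk_eq_zero (LinearMap.range f.hom.hom)).1 this

variable [Module.Finite k S]

variable (k S) in
/-- The generator of the regular module. -/
def FDModCat.one : (FDModCat.regular k S).obj := (1 : S)

/-- The morphism from the regular module that corresponds to an element. -/
def FDModCat.ofElement {M : FDModCat k S} (m : M.obj) : FDModCat.regular k S ⟶ M :=
  ObjectProperty.homMk (show ModuleCat.of S S ⟶ M.obj from
    ModuleCat.ofHom (LinearMap.toSpanSingleton S M.obj m))

lemma FDModCat.ofElement_one {M : FDModCat k S} (m : M.obj) :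
    (FDModCat.ofElement m).hom.hom (FDModCat.one k S) = m := one_smul S m

lemma FDModCat.regular_hom_ext {M : FDModCat k S} {f g : FDModCat.regular k S ⟶ M}
    (h : f.hom.hom (FDModCat.one k S) = g.hom.hom (FDModCat.one k S)) : f = g := by
  apply ObjectProperty.hom_ext
  apply ModuleCat.hom_ext
  exact LinearMap.ext_ring (R := S) h

instance : Projective (FDModCat.regular k S) where
  factors f e _ := by
    obtain ⟨x, hx⟩ := FDModCat.surjective_of_epi e (f.hom.hom (FDModCat.one k S))
    refine ⟨FDModCat.ofElement x, FDModCat.regular_hom_ext ?_⟩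
    exact (congrArg e.hom.hom (FDModCat.ofElement_one x)).trans hx

variable (k S) in
lemma FDModCat.isSeparator_regular : IsSeparator (FDModCat.regular k S) := by
  rw [isSeparator_def]
  intro M N f g h
  ext x
  have := congrArg (fun t => t.hom.hom (FDModCat.one k S)) (h (FDModCat.ofElement x))
  have e (f : M ⟶ N) : (FDModCat.ofElement x ≫ f).hom.hom (FDModCat.one k S) = f.hom.hom x :=
    congrArg f.hom.hom (FDModCat.ofElement_one x)
  exact (e f).symm.trans (this.trans (e g))

lemma FDModCat.finite_regular_hom (M : FDModCat k S) :
    Module.Finite k (FDModCat.regular k S ⟶ M) :=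
  have : Module.Finite k M.obj := M.property
  Module.Finite.of_injective
    ({ toFun := fun f => f.hom.hom (FDModCat.one k S)
       map_add' := fun _ _ => rfl
       map_smul' := fun _ _ => rfl } : (FDModCat.regular k S ⟶ M) →ₗ[k] M.obj)
    fun _ _ h => FDModCat.regular_hom_ext h

end FiniteModules

/-! ### Transport of the tensor structure along an equivalence -/

section Transport

open Limits Monoidal

/-- As a category `Transported E` is `D`; only its tensor product comes from `C`, so the additive
structure is inherited from `D`. -/
instance {C D : Type*} [Category* C] [MonoidalCategory C] [Category* D] [Preadditive D]
    (E : C ≌ D) : Preadditive (Transported E) where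
  homGroup := (inferInstance : Preadditive D).homGroup
  add_comp := (inferInstance : Preadditive D).add_comp
  comp_add := (inferInstance : Preadditive D).comp_add

instance (k : Type*) [CommRing k] {C D : Type*} [Category* C] [MonoidalCategory C] [Category* D]
    [Preadditive D] [Linear k D] (E : C ≌ D) : Linear k (Transported E) where
  homModule := (inferInstance : Linear k D).homModule
  smul_comp := (inferInstance : Linear k D).smul_comp
  comp_smul := (inferInstance : Linear k D).comp_smul

variable {k : Type w} [Field k] {C : Type u} [Category.{v} C] [Abelian C] [Linear k C]
    [MonoidalCategory C] [MonoidalPreadditive C] [MonoidalLinear k C] [RigidCategory C]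

/-- `exists_leftHopf_of_projective_separator` for a category that is equivalent to a category with
smaller Hom's. -/
theorem exists_leftHopf_of_equivalence {D : Type (w + 1)} [Category.{w} D] [Preadditive D]
    [Linear k D] (E : C ≌ D) [E.functor.Additive] [E.functor.Linear k] (Q : D) [Projective Q]
    (hs : IsSeparator Q) (hfin : ∀ X : D, Module.Finite k (Q ⟶ X)) :
    ∃ (R : Type w) (_ : Ring R) (_ : Algebra k R) (_ : Module.Finite k R)
      (A : Type w) (_ : Ring A) (_ : Algebra k A) (_ : Module.Finite k A)
      (H : LeftBialgebroid k R A), H.IsLeftHopf ∧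
      ∃ E : C ≌ H.FDMod,
        E.functor.Additive ∧ E.functor.Linear k ∧ Nonempty E.functor.Monoidal := by
  -- The rings R and A are built from Hom groups and must lie in the universe of k. Those of `D` do,
  -- so the reconstruction is carried out in `D` with the tensor product of `C`.
  let E' : C ≌ Transported E := equivalenceTransported E
  have : E'.functor.Additive := ⟨E.functor.map_add⟩
  have : E'.functor.Linear k := ⟨fun f c => Functor.Linear.map_smul (F := E.functor) f c⟩
  have : E'.inverse.Linear k := inferInstance
  have : HasFiniteProducts (Transported E) :=
    ⟨fun n => Adjunction.hasLimitsOfShape_of_equivalence E'.inverse⟩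
  letI : Abelian (Transported E) :=
    { __ := (inferInstance : Preadditive (Transported E))
      __ := abelianOfEquivalence E'.inverse }
  have : MonoidalPreadditive (Transported E) := monoidalPreadditive_of_faithful E'.inverse
  have : MonoidalLinear k (Transported E) := .ofFaithful k E'.inverse
  letI : RigidCategory (Transported E) := rigidCategoryOfEquivalence E'.symm.toAdjunction
  have : Projective (C := Transported E) Q := ‹Projective Q›
  obtain ⟨R, _, _, _, A, _, _, _, H, hH, G, _, _, ⟨_⟩⟩ :=
    exists_leftHopf_of_projective_separator (C := Transported E) (k := k) Q hs hfin
  exact ⟨R, _, _, ‹_›, A, _, _, ‹_›, H, hH, E'.trans G,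
    inferInstanceAs (E'.functor ⋙ G.functor).Additive,
    inferInstanceAs ((E'.functor ⋙ G.functor).Linear k),
    ⟨(inferInstance : (E'.functor ⋙ G.functor).Monoidal)⟩⟩

end Transport

end

theorem mainTheorem5 (k : Type w) [Field k]
    (C : Type u) [Category.{v} C] [Abelian C] [Linear k C]
    [MonoidalCategory C] [MonoidalPreadditive C] [MonoidalLinear k C] [RigidCategory C]
    (_ : Function.Bijective fun c : k => c • 𝟙 (𝟙_ C))
    (hfinite : IsFiniteLinearCategory k C) :
    ∃ (R : Type w) (_ : Ring R) (_ : Algebra k R) (_ : Module.Finite k R)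
      (A : Type w) (_ : Ring A) (_ : Algebra k A) (_ : Module.Finite k A)
      (H : LeftBialgebroid k R A), H.IsLeftHopf ∧
      ∃ E : C ≌ H.FDMod,
        E.functor.Additive ∧ E.functor.Linear k ∧ Nonempty E.functor.Monoidal := by
  obtain ⟨S, _, _, _, E, _, _⟩ := hfinite
  -- The projective generator is the object that corresponds to the regular S-module.
  exact exists_leftHopf_of_equivalence E (FDModCat.regular k S) (FDModCat.isSeparator_regular k S)
    FDModCat.finite_regular_hom
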